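/- Let $I\subset\mathbb R$ be an open interval, $r_0\in I$, and $F,G,H:I\to(0,\infty)$ smooth. Let $U\subset\mathbb R^2$ be a non-empty open set with coordinates $(x,y)$ (a local isothermal coordinate domain of a Riemann surface $\Sigma$), with Riemannian metric $g_\Sigma=h\,(dx^2+dy^2)$, where $h:U\to(0,\infty)$ is smooth, and put $R_\Sigma:=-h^{-1}(\partial_x^2+\partial_y^2)\log h$ (the scalar curvature of $g_\Sigma$). Let $A=A_1\,dx+A_2\,dy$ be a smooth 1-form on $U$ with $dA=h\,dx\wedge dy$. On $M=I\times\mathbb R\times U$, with coordinates $(r,\psi,x,y)$, consider the Page–Pope metric $$g=F(r)\,dr^2+G(r)\,(d\psi+A)^2+H(r)\,g_\Sigma ,$$ and orient $M$ by $dr\wedge d\psi\wedge dx\wedge dy$; equivalently, for the coframe $\beta^0=\sqrt G(d\psi+A)$, $\beta^1=\sqrt F\,dr$, $\beta^2=\sqrt{Hh}\,dx$, $\beta^3=\sqrt{Hh}\,dy$, the form $\beta^0\wedge\beta^1-\beta^2\wedge\beta^3$ is self-dual and $\beta^0\wedge\beta^1+\beta^2\wedge\beta^3$ is anti-self-dual.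 For constants $c_\pm>0$ put $$\Omega_\pm^2(r)=\frac{c_\pm}{H(r)}\exp\Big[\pm\int_{r_0}^r\frac{\sqrt{F(t)G(t)}}{H(t)}\,dt\Big].$$ Let $C_{abcd}$ be the Weyl tensor of $g$ and $*C_{abcd}=\tfrac12\varepsilon_{ab}{}^{ef}C_{efcd}$. Then, for either choice of sign (upper signs together, or lower signs together), $*C=\mp C$ on all of $M$ if and only if $R_\Sigma$ is constant and there are real constants $a_\pm,b_\pm$ such that on $I$ $$G=\frac{R_\Sigma}{2}\,H+\frac{b_\pm}{\Omega_\pm^2}+\frac{a_\pm}{\Omega_\pm^4H}.$$ -/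

import Mathlib

open Set
open scoped ContDiff

noncomputable section

/-! ### Curvature of a Riemannian metric in local coordinates on an open subset of `ℝ⁴` -/

namespace LocalGeometry

/-- A metric in coordinates: the matrix `g_{ab}` at every point. -/
abbrev Metric4 := (Fin 4 → ℝ) → Matrix (Fin 4) (Fin 4) ℝ

/-- The coordinate partial derivative `∂_a f`. -/
def pd (a : Fin 4) (f : (Fin 4 → ℝ) → ℝ) (p : Fin 4 → ℝ) : ℝ :=
  fderiv ℝ f p (Pi.single a 1)

/-- Christoffel symbols
`Γ^a_{bc} = ½ g^{ad} (∂_b g_{dc} + ∂_c g_{db} - ∂_d g_{bc})` of the Levi-Civita connection. -/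
def christoffel (g : Metric4) (a b c : Fin 4) (p : Fin 4 → ℝ) : ℝ :=
  (1 / 2) * ∑ d, (g p)⁻¹ a d *
    (pd b (fun q => g q d c) p + pd c (fun q => g q d b) p - pd d (fun q => g q b c) p)

/-- Riemann tensor
`R^a_{bcd} = ∂_c Γ^a_{db} - ∂_d Γ^a_{cb} + Γ^a_{ce} Γ^e_{db} - Γ^a_{de} Γ^e_{cb}`. -/
def riemannUp (g : Metric4) (a b c d : Fin 4) (p : Fin 4 → ℝ) : ℝ :=
  pd c (christoffel g a d b) p - pd d (christoffel g a c b) p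
    + ∑ e, (christoffel g a c e p * christoffel g e d b p
        - christoffel g a d e p * christoffel g e c b p)

/-- `R_{abcd} = g_{ae} R^e_{bcd}`. -/
def riemann (g : Metric4) (a b c d : Fin 4) (p : Fin 4 → ℝ) : ℝ :=
  ∑ e, g p a e * riemannUp g e b c d p

/-- Ricci tensor `R_{bd} = R^a_{bad}`. -/
def ricci (g : Metric4) (b d : Fin 4) (p : Fin 4 → ℝ) : ℝ :=
  ∑ a, riemannUp g a b a d p

/-- Scalar curvature `R = g^{ab} R_{ab}`. -/
def scalarCurvature (g : Metric4) (p : Fin 4 → ℝ) : ℝ :=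
  ∑ a, ∑ b, (g p)⁻¹ a b * ricci g a b p

/-- The Weyl tensor `C_{abcd}` in dimension four. -/
def weyl (g : Metric4) (a b c d : Fin 4) (p : Fin 4 → ℝ) : ℝ :=
  riemann g a b c d p
    - (1 / 2) * (g p a c * ricci g b d p - g p a d * ricci g b c p
        - g p b c * ricci g a d p + g p b d * ricci g a c p)
    + scalarCurvature g p / 6 * (g p a c * g p b d - g p a d * g p b c)

/-- The Levi-Civita symbol with `[0123] = 1`, as the determinant of the matrix whose rows are the
basis vectors with the given indices. -/
def leviCivita (a b c d : Fin 4) : ℝ :=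
  Matrix.det (Matrix.of fun i j : Fin 4 => if ![a, b, c, d] i = j then (1 : ℝ) else 0)

/-- The volume form `ε_{abcd} = √(det g) [abcd]` of `g`, for the orientation in which the
coordinates `(p 0, p 1, p 2, p 3)`, in this order, are positively oriented. -/
def volumeForm (g : Metric4) (a b c d : Fin 4) (p : Fin 4 → ℝ) : ℝ :=
  Real.sqrt (g p).det * leviCivita a b c d

/-- The Hodge dual `(*C)_{abcd} = ½ ε_{ab}^{ef} C_{efcd}` of the Weyl tensor. -/
def hodgeWeyl (g : Metric4) (a b c d : Fin 4) (p : Fin 4 → ℝ) : ℝ :=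
  (1 / 2) * ∑ e, ∑ f, (∑ k, ∑ l, volumeForm g a b k l p * (g p)⁻¹ k e * (g p)⁻¹ l f)
    * weyl g e f c d p

end LocalGeometry

/-! ### The Page–Pope ansatz

The coordinates on the surface `Σ` are `(x, y) : ℝ × ℝ`, and the coordinates on the 4-manifold are
`p 0 = r`, `p 1 = ψ`, `p 2 = x`, `p 3 = y`. With the orthonormal coframe `β⁰ = √G (dψ + A)`,
`β¹ = √F dr`, `β² = √(H h) dx`, `β³ = √(H h) dy`, the orientation `dr ∧ dψ ∧ dx ∧ dy > 0` is the one
in which `β⁰ ∧ β¹ - β² ∧ β³` is self-dual and `β⁰ ∧ β¹ + β² ∧ β³` is anti-self-dual. -/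

namespace PagePope

/-- `∂f/∂x` on the surface. -/
def dX (f : ℝ × ℝ → ℝ) (q : ℝ × ℝ) : ℝ := fderiv ℝ f q (1, 0)

/-- `∂f/∂y` on the surface. -/
def dY (f : ℝ × ℝ → ℝ) (q : ℝ × ℝ) : ℝ := fderiv ℝ f q (0, 1)

/-- The curvature `R_Σ = -h⁻¹ (∂_x² + ∂_y²) log h` (the scalar curvature, i.e. twice the Gaussian
curvature) of the surface metric `g_Σ = h (dx² + dy²)`. -/
def surfaceCurvature (h : ℝ × ℝ → ℝ) (q : ℝ × ℝ) : ℝ :=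
  -(h q)⁻¹ * (dX (dX fun w => Real.log (h w)) q + dY (dY fun w => Real.log (h w)) q)

/-- The components of the 1-form `dψ + A`, where `A = A₁ dx + A₂ dy`. -/
def connectionForm (A₁ A₂ : ℝ × ℝ → ℝ) (p : Fin 4 → ℝ) : Fin 4 → ℝ :=
  ![0, 1, A₁ (p 2, p 3), A₂ (p 2, p 3)]

/-- The Page–Pope metric `g = F(r) dr² + G(r) (dψ + A)² + H(r) h (dx² + dy²)`. -/
def metric (F G H : ℝ → ℝ) (h A₁ A₂ : ℝ × ℝ → ℝ) : LocalGeometry.Metric4 := fun p =>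
  F (p 0) • Matrix.diagonal ![1, 0, 0, 0]
    + G (p 0) • Matrix.vecMulVec (connectionForm A₁ A₂ p) (connectionForm A₁ A₂ p)
    + (H (p 0) * h (p 2, p 3)) • Matrix.diagonal ![0, 0, 1, 1]

/-- The coordinate domain: `r ∈ I`, `ψ ∈ ℝ`, `(x, y) ∈ U`. -/
def domain (I : Set ℝ) (U : Set (ℝ × ℝ)) : Set (Fin 4 → ℝ) :=
  {p | p 0 ∈ I ∧ (p 2, p 3) ∈ U}

/-- The conformal factor `Ω² = (c / H) exp (s ∫ √(F G) / H dr)`; here `s = 1` gives `Ω₊²` and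
`s = -1` gives `Ω₋²`. The choice of the primitive is fixed by its zero `r₀`. -/
def OmegaSq (F G H : ℝ → ℝ) (s c r₀ r : ℝ) : ℝ :=
  c / H r * Real.exp (s * ∫ t in r₀..r, Real.sqrt (F t * G t) / H t)

end PagePope

end

noncomputable section

namespace LocalGeometry

/-! ### Second order jets of functions of four variables -/

/-! Put `y = G/H` and let `z` be the primitive of `√(F G)/H` vanishing at `r₀`. Then `g/H = dz²/y +
y (dψ + A)² + g_Σ`, so by conformal invariance the condition on the Weyl tensor can involve only `y`
as a function of `z` and the curvature of `g_Σ`. The proof computes with `g` itself. At a point, the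
curvature is a rational expression in the 2-jets of the metric coefficients. Since `dA` is the area
form of `g_Σ`, it is parallel on the surface, and the Riemann tensor has only five independent
coefficients in the coframe `dr, dψ + A, dx, dy` (`rm_eq`). Removing traces leaves two for the Weyl
tensor: an even one `u` and a mixed one `m` (`weyl_curvForm`). The Hodge star exchanges them up to
the factor `v = √(F G) H h` (`star_weylForm`), so `*C = -s C` is the single scalar equation `m / v =
-s u`. Up to common factors `m / v` is `dy/dz` and `u` is `y'' + 2 y - R_Σ`, so the equation reads
`y'' + 3 s y' + 2 y = R_Σ` (`hodgeWeyl_eq_iff`). The left side depends on `r` only and the right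
side on the surface point only, hence both are a constant `k`. The characteristic roots are `-s` and
`-2s` (`ode_iff`), so `y = k/2 + b e^{-sz} + a e^{-2sz}`. Multiplying by `H` and using `Ω² = c
e^{sz}/H` gives the stated formula for `G`. -/

lemma pd_congr {f g : (Fin 4 → ℝ) → ℝ} {p : Fin 4 → ℝ} (hfg : f =ᶠ[nhds p] g) (a : Fin 4) :
    pd a f p = pd a g p := by
  simp only [pd, hfg.fderiv_eq]

lemma pd_add {f g : (Fin 4 → ℝ) → ℝ} {p : Fin 4 → ℝ} (hf : DifferentiableAt ℝ f p)
    (hg : DifferentiableAt ℝ g p) (a : Fin 4) :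
    pd a (fun q => f q + g q) p = pd a f p + pd a g p := by
  simp [pd, fderiv_fun_add hf hg]

lemma pd_sub {f g : (Fin 4 → ℝ) → ℝ} {p : Fin 4 → ℝ} (hf : DifferentiableAt ℝ f p)
    (hg : DifferentiableAt ℝ g p) (a : Fin 4) :
    pd a (fun q => f q - g q) p = pd a f p - pd a g p := by
  simp [pd, fderiv_fun_sub hf hg]

lemma pd_mul {f g : (Fin 4 → ℝ) → ℝ} {p : Fin 4 → ℝ} (hf : DifferentiableAt ℝ f p)
    (hg : DifferentiableAt ℝ g p) (a : Fin 4) :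
    pd a (fun q => f q * g q) p = pd a f p * g p + f p * pd a g p := by
  simp [pd, fderiv_fun_mul hf hg]
  ring

lemma pd_const_mul {f : (Fin 4 → ℝ) → ℝ} {p : Fin 4 → ℝ} (hf : DifferentiableAt ℝ f p)
    (c : ℝ) (a : Fin 4) : pd a (fun q => c * f q) p = c * pd a f p := by
  simp [pd, fderiv_const_mul hf]

lemma pd_sum {f : Fin 4 → (Fin 4 → ℝ) → ℝ} {p : Fin 4 → ℝ}
    (hf : ∀ i, DifferentiableAt ℝ (f i) p) (a : Fin 4) :
    pd a (fun q => ∑ i, f i q) p = ∑ i, pd a (f i) p := by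
  simp [pd, fderiv_fun_sum (fun i _ => hf i)]

lemma differentiableAt_pd {f : (Fin 4 → ℝ) → ℝ} {p : Fin 4 → ℝ} (hf : ContDiffAt ℝ 2 f p)
    (a : Fin 4) : DifferentiableAt ℝ (pd a f) p := by
  have h1 : ContDiffAt ℝ 1 (fderiv ℝ f) p := hf.fderiv_right (by norm_num)
  exact (h1.differentiableAt (by norm_num)).clm_apply (differentiableAt_const _)

lemma pd_comm {f : (Fin 4 → ℝ) → ℝ} {p : Fin 4 → ℝ} (hf : ContDiffAt ℝ 2 f p)
    (a b : Fin 4) : pd a (pd b f) p = pd b (pd a f) p := by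
  have h1 : DifferentiableAt ℝ (fderiv ℝ f) p :=
    (hf.fderiv_right (m := 1) (by norm_num)).differentiableAt (by norm_num)
  have key : ∀ a b, pd a (pd b f) p
      = fderiv ℝ (fderiv ℝ f) p (Pi.single a 1) (Pi.single b 1) := by
    intro a b
    have : pd b f = fun q => fderiv ℝ f q (Pi.single b 1) := rfl
    rw [this, pd, fderiv_clm_apply h1 (differentiableAt_const _)]
    simp
  rw [key, key]
  exact (hf.isSymmSndFDerivAt (by simp)) _ _

lemma eventually_differentiableAt {f : (Fin 4 → ℝ) → ℝ} {p : Fin 4 → ℝ}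
    (hf : ContDiffAt ℝ 2 f p) : ∀ᶠ q in nhds p, DifferentiableAt ℝ f q :=
  (hf.eventually (by simp)).mono fun _ h => h.differentiableAt (by norm_num)

/-- Value, first and second partial derivatives at a point. -/
structure Jet where
  /-- the value -/
  val : ℝ
  /-- the first partial derivatives -/
  d : Fin 4 → ℝ
  /-- the second partial derivatives -/
  dd : Fin 4 → Fin 4 → ℝ

/-- The sum of two jets. -/
def Jet.add (j k : Jet) : Jet :=
  ⟨j.val + k.val, fun a => j.d a + k.d a, fun a b => j.dd a b + k.dd a b⟩

/-- Leibniz rule for products of jets. -/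
def Jet.mul (j k : Jet) : Jet :=
  ⟨j.val * k.val, fun a => j.d a * k.val + j.val * k.d a,
    fun a b => j.dd a b * k.val + j.d a * k.d b + j.d b * k.d a + j.val * k.dd a b⟩

/-- The jet of a constant. -/
def Jet.const (c : ℝ) : Jet := ⟨c, fun _ => 0, fun _ _ => 0⟩

/-- `f` is twice continuously differentiable at `p`, with jet `j`. -/
structure HasJet (f : (Fin 4 → ℝ) → ℝ) (p : Fin 4 → ℝ) (j : Jet) : Prop where
  contDiffAt : ContDiffAt ℝ 2 f p
  val : f p = j.val
  d : ∀ a, pd a f p = j.d a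
  dd : ∀ a b, pd a (pd b f) p = j.dd a b

lemma HasJet.const (c : ℝ) (p : Fin 4 → ℝ) : HasJet (fun _ => c) p (Jet.const c) := by
  have : ∀ b, pd b (fun _ => c) = fun _ => 0 := by
    intro b; ext q; simp [pd]
  refine ⟨contDiffAt_const, rfl, fun a => by simp [this, Jet.const], fun a b => ?_⟩
  rw [this]; simp [pd, Jet.const]

lemma HasJet.add {f g : (Fin 4 → ℝ) → ℝ} {p : Fin 4 → ℝ} {j k : Jet}
    (hf : HasJet f p j) (hg : HasJet g p k) :
    HasJet (fun q => f q + g q) p (j.add k) := by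
  have hf1 := hf.contDiffAt.differentiableAt (by norm_num)
  have hg1 := hg.contDiffAt.differentiableAt (by norm_num)
  refine ⟨hf.contDiffAt.add hg.contDiffAt, by simp [Jet.add, hf.val, hg.val],
    fun a => by rw [pd_add hf1 hg1, hf.d, hg.d]; rfl, fun a b => ?_⟩
  have : pd b (fun q => f q + g q) =ᶠ[nhds p] fun q => pd b f q + pd b g q := by
    filter_upwards [eventually_differentiableAt hf.contDiffAt,
      eventually_differentiableAt hg.contDiffAt] with q h1 h2
    exact pd_add h1 h2 b
  rw [pd_congr this, pd_add (differentiableAt_pd hf.contDiffAt b)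
    (differentiableAt_pd hg.contDiffAt b), hf.dd, hg.dd]
  rfl

lemma HasJet.mul {f g : (Fin 4 → ℝ) → ℝ} {p : Fin 4 → ℝ} {j k : Jet}
    (hf : HasJet f p j) (hg : HasJet g p k) :
    HasJet (fun q => f q * g q) p (j.mul k) := by
  have hf1 := hf.contDiffAt.differentiableAt (by norm_num)
  have hg1 := hg.contDiffAt.differentiableAt (by norm_num)
  have hf2 := differentiableAt_pd hf.contDiffAt
  have hg2 := differentiableAt_pd hg.contDiffAt
  refine ⟨hf.contDiffAt.mul hg.contDiffAt, by simp [Jet.mul, hf.val, hg.val],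
    fun a => by rw [pd_mul hf1 hg1, hf.d, hg.d, hf.val, hg.val]; rfl, fun a b => ?_⟩
  have : pd b (fun q => f q * g q) =ᶠ[nhds p] fun q => pd b f q * g q + f q * pd b g q := by
    filter_upwards [eventually_differentiableAt hf.contDiffAt,
      eventually_differentiableAt hg.contDiffAt] with q h1 h2
    exact pd_mul h1 h2 b
  rw [pd_congr this, pd_add ((hf2 b).fun_mul hg1) (hf1.fun_mul (hg2 b)), pd_mul (hf2 b) hg1,
    pd_mul hf1 (hg2 b), hf.dd, hg.dd, hf.d, hf.d, hg.d, hg.d, hf.val, hg.val]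
  simp only [Jet.mul]
  ring

/-! ### The Riemann tensor with lowered index -/

/-- Christoffel symbols of the first kind. -/
def christoffelLow (g : Metric4) (d b c : Fin 4) (p : Fin 4 → ℝ) : ℝ :=
  (1 / 2) * (pd b (fun q => g q d c) p + pd c (fun q => g q d b) p - pd d (fun q => g q b c) p)

lemma christoffel_eq (g : Metric4) (a b c : Fin 4) (p : Fin 4 → ℝ) :
    christoffel g a b c p = ∑ d, (g p)⁻¹ a d * christoffelLow g d b c p := by
  simp only [christoffel, christoffelLow, Finset.mul_sum]
  exact Finset.sum_congr rfl fun d _ => by ring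

lemma differentiableAt_det {M : Metric4} {p : Fin 4 → ℝ}
    (hM : ∀ i j, DifferentiableAt ℝ (fun q => M q i j) p) :
    DifferentiableAt ℝ (fun q => (M q).det) p := by
  simp only [Matrix.det_apply]
  exact DifferentiableAt.fun_sum fun σ _ =>
    (HasFDerivAt.finsetProd fun i _ =>
      (hM (σ i) i).hasFDerivAt).differentiableAt.const_smul _

lemma differentiableAt_inv {M : Metric4} {p : Fin 4 → ℝ}
    (hM : ∀ i j, DifferentiableAt ℝ (fun q => M q i j) p) (hdet : (M p).det ≠ 0) (i j : Fin 4) :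
    DifferentiableAt ℝ (fun q => (M q)⁻¹ i j) p := by
  simp only [Matrix.inv_def, Matrix.smul_apply, smul_eq_mul, Matrix.adjugate_apply,
    Ring.inverse_eq_inv']
  refine ((differentiableAt_det hM).inv hdet).mul (differentiableAt_det fun k l => ?_)
  by_cases hk : k = j
  · simp [Matrix.updateRow_apply, hk]
  · simpa [Matrix.updateRow_apply, hk] using hM k l

lemma mul_inv_apply_sum {A : Matrix (Fin 4) (Fin 4) ℝ} (hA : A.det ≠ 0) (v : Fin 4 → ℝ)
    (i : Fin 4) : ∑ a, A i a * ∑ d, A⁻¹ a d * v d = v i := by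
  have : A.mulVec (A⁻¹.mulVec v) = v := by
    rw [Matrix.mulVec_mulVec, Matrix.mul_nonsing_inv _ hA.isUnit, Matrix.one_mulVec]
  exact congrFun this i

lemma inv_mul_apply_sum {A : Matrix (Fin 4) (Fin 4) ℝ} (hA : A.det ≠ 0) (v : Fin 4 → ℝ)
    (i : Fin 4) : ∑ a, A⁻¹ i a * ∑ d, A a d * v d = v i := by
  have : A⁻¹.mulVec (A.mulVec v) = v := by
    rw [Matrix.mulVec_mulVec, Matrix.nonsing_inv_mul _ hA.isUnit, Matrix.one_mulVec]
  exact congrFun this i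

lemma differentiableAt_christoffelLow {g : Metric4} {p : Fin 4 → ℝ}
    (hg : ∀ i j, ContDiffAt ℝ 2 (fun q => g q i j) p) (d b c : Fin 4) :
    DifferentiableAt ℝ (christoffelLow g d b c) p :=
  (((differentiableAt_pd (hg _ _) _).add (differentiableAt_pd (hg _ _) _)).sub
    (differentiableAt_pd (hg _ _) _)).const_mul _

/-- The product rule applied to `Γ_{e,bd} = g_{ea} Γ^a_{bd}`. -/
lemma sum_metric_mul_pd_christoffel {g : Metric4} {p : Fin 4 → ℝ}
    (hg : ∀ i j, ContDiffAt ℝ 2 (fun q => g q i j) p) (hdet : (g p).det ≠ 0)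
    (e b c d : Fin 4) :
    ∑ a, g p e a * pd c (christoffel g a d b) p
      = pd c (christoffelLow g e d b) p
        - ∑ a, pd c (fun q => g q e a) p * christoffel g a d b p := by
  have hg1 : ∀ i j, DifferentiableAt ℝ (fun q => g q i j) p :=
    fun i j => (hg i j).differentiableAt (by norm_num)
  have hdet' : ∀ᶠ q in nhds p, (g q).det ≠ 0 :=
    (differentiableAt_det hg1).continuousAt.eventually_ne hdet
  have hΓ : ∀ a, DifferentiableAt ℝ (christoffel g a d b) p := by
    intro a
    have : christoffel g a d b = fun q => ∑ k, (g q)⁻¹ a k * christoffelLow g k d b q := by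
      ext q; exact christoffel_eq g a d b q
    rw [this]
    exact DifferentiableAt.fun_sum fun k _ =>
      (differentiableAt_inv hg1 hdet a k).mul (differentiableAt_christoffelLow hg k d b)
  -- The identity is about to be differentiated, so it is needed near `p`, where the metric stays
  -- nondegenerate.
  have hlow : christoffelLow g e d b =ᶠ[nhds p] fun q => ∑ a, g q e a * christoffel g a d b q := by
    filter_upwards [hdet'] with q hq
    simp only [christoffel_eq]
    exact (mul_inv_apply_sum hq (fun k => christoffelLow g k d b q) e).symm
  rw [pd_congr hlow, pd_sum fun a => (hg1 e a).fun_mul (hΓ a)]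
  simp only [pd_mul (hg1 e _) (hΓ _), Finset.sum_add_distrib]
  ring

/-- This is metric compatibility `∇g = 0`; the two terms with the derivative index exchanged cancel
by symmetry of `g`. -/
lemma pd_metric_eq_christoffelLow {g : Metric4} (hsymm : ∀ q i j, g q i j = g q j i)
    (c e a : Fin 4) (p : Fin 4 → ℝ) :
    pd c (fun q => g q e a) p = christoffelLow g e c a p + christoffelLow g a c e p := by
  have h1 : (fun q => g q a e) = fun q => g q e a := by ext q; exact hsymm q a e
  have h2 : (fun q => g q a c) = fun q => g q c a := by ext q; exact hsymm q a c
  have h3 : (fun q => g q e c) = fun q => g q c e := by ext q; exact hsymm q e c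
  simp only [christoffelLow, h1, h2, h3]
  ring

/-- The Riemann tensor with all indices lowered, in terms of second derivatives of the metric. -/
lemma riemann_eq {g : Metric4} {p : Fin 4 → ℝ} (hsymm : ∀ q i j, g q i j = g q j i)
    (hg : ∀ i j, ContDiffAt ℝ 2 (fun q => g q i j) p) (hdet : (g p).det ≠ 0)
    (e b c d : Fin 4) :
    riemann g e b c d p
      = (1 / 2) * (pd c (pd b fun q => g q e d) p + pd d (pd e fun q => g q c b) p
          - pd c (pd e fun q => g q d b) p - pd d (pd b fun q => g q e c) p)
        + ∑ a, ∑ f, (g p)⁻¹ a f * (christoffelLow g a d e p * christoffelLow g f c b p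
            - christoffelLow g a c e p * christoffelLow g f d b p) := by
  have hpd : ∀ c d b, pd c (christoffelLow g e d b) p
      = (1 / 2) * (pd c (pd d fun q => g q e b) p + pd c (pd b fun q => g q e d) p
        - pd c (pd e fun q => g q d b) p) := by
    intro c d b
    have hd := fun a i j => differentiableAt_pd (hg i j) a
    have : christoffelLow g e d b = fun q => (1 / 2) * (pd d (fun q => g q e b) q
      + pd b (fun q => g q e d) q - pd e (fun q => g q d b) q) := rfl
    rw [this, pd_const_mul (((hd _ _ _).fun_add (hd _ _ _)).fun_sub (hd _ _ _)),
      pd_sub ((hd _ _ _).fun_add (hd _ _ _)) (hd _ _ _), pd_add (hd _ _ _) (hd _ _ _)]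
  have hquad : ∀ c d b, ∑ a, g p e a * ∑ k, christoffel g a c k p * christoffel g k d b p
      = ∑ k, christoffelLow g e c k p * christoffel g k d b p := by
    intro c d b
    have h1 : ∀ k, ∑ a, g p e a * christoffel g a c k p = christoffelLow g e c k p := fun k => by
      simp only [christoffel_eq]
      exact mul_inv_apply_sum hdet (fun j => christoffelLow g j c k p) e
    simp only [Finset.mul_sum, ← h1, Finset.sum_mul]
    rw [Finset.sum_comm]
    exact Finset.sum_congr rfl fun _ _ => Finset.sum_congr rfl fun _ _ => by ring
  -- By metric compatibility `∂_c g_{ea}` splits in two. One half cancels the quadratic terms of the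
  -- Riemann tensor (`hquad`); the other half is the quadratic expression in the statement.
  have hdiff : ∀ c d b, ∑ a, pd c (fun q => g q e a) p * christoffel g a d b p
      = ∑ a, christoffelLow g e c a p * christoffel g a d b p
        + ∑ a, ∑ f, (g p)⁻¹ a f * (christoffelLow g a c e p * christoffelLow g f d b p) := by
    intro c d b
    rw [← Finset.sum_add_distrib]
    refine Finset.sum_congr rfl fun a _ => ?_
    rw [pd_metric_eq_christoffelLow hsymm, add_mul]
    congr 1
    rw [christoffel_eq, Finset.mul_sum]
    exact Finset.sum_congr rfl fun _ _ => by ring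
  have hexp : riemann g e b c d p
      = ∑ a, g p e a * pd c (christoffel g a d b) p - ∑ a, g p e a * pd d (christoffel g a c b) p
        + (∑ a, g p e a * ∑ k, christoffel g a c k p * christoffel g k d b p
          - ∑ a, g p e a * ∑ k, christoffel g a d k p * christoffel g k c b p) := by
    simp only [riemann, riemannUp, Finset.sum_sub_distrib, mul_add, mul_sub,
      Finset.sum_add_distrib]
  rw [hexp, sum_metric_mul_pd_christoffel hg hdet, sum_metric_mul_pd_christoffel hg hdet, hquad,
    hquad, hpd, hpd, hdiff, hdiff, pd_comm (hg e b) c d]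
  simp only [mul_sub, Finset.sum_sub_distrib]
  ring

/-- Trace form of the Ricci tensor. -/
lemma ricci_eq {g : Metric4} {p : Fin 4 → ℝ} (hdet : (g p).det ≠ 0) (b d : Fin 4) :
    ricci g b d p = ∑ a, ∑ e, (g p)⁻¹ a e * riemann g e b a d p := by
  simp only [ricci, riemann]
  exact Finset.sum_congr rfl fun a _ =>
    (inv_mul_apply_sum hdet (fun k => riemannUp g k b a d p) a).symm

/-- Reduces a comparison of 256 components to the 36 with increasing index pairs. -/
lemma eq_of_antisymm {T T' : Fin 4 → Fin 4 → Fin 4 → Fin 4 → ℝ}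
    (h1 : ∀ a b c d, T b a c d = -T a b c d) (h2 : ∀ a b c d, T a b d c = -T a b c d)
    (h1' : ∀ a b c d, T' b a c d = -T' a b c d) (h2' : ∀ a b c d, T' a b d c = -T' a b c d)
    (h : ∀ a b c d, a < b → c < d → T a b c d = T' a b c d) (a b c d : Fin 4) :
    T a b c d = T' a b c d := by
  have key : ∀ a b c d, a < b → T a b c d = T' a b c d := by
    intro a b c d hab
    rcases lt_trichotomy c d with hcd | rfl | hcd
    · exact h a b c d hab hcd
    · have e1 := h2 a b c c
      have e2 := h2' a b c c
      linarith
    · rw [h2 a b d c, h2' a b d c, h a b d c hab hcd]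
  rcases lt_trichotomy a b with hab | rfl | hab
  · exact key a b c d hab
  · have e1 := h1 a a c d
    have e2 := h1' a a c d
    linarith
  · rw [h1 b a c d, h1' b a c d, key b a c d hab]

/-- The Levi-Civita symbol is a quotient of Vandermonde determinants. -/
lemma leviCivita_eq (a b c d : Fin 4) :
    leviCivita a b c d = (((b : ℕ) : ℝ) - (a : ℕ)) * ((c : ℕ) - (a : ℕ)) * ((d : ℕ) - (a : ℕ))
      * ((c : ℕ) - (b : ℕ)) * ((d : ℕ) - (b : ℕ)) * ((d : ℕ) - (c : ℕ)) / 12 := by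
  -- The 0-1 matrix selects rows, turning the Vandermonde matrix with nodes 0, 1, 2, 3, of
  -- determinant 12, into the one with nodes `a, b, c, d`.
  have hmul : (Matrix.of fun i j : Fin 4 => if ![a, b, c, d] i = j then (1 : ℝ) else 0)
      * Matrix.vandermonde (fun i : Fin 4 => ((i : ℕ) : ℝ))
      = Matrix.vandermonde fun i => ((![a, b, c, d] i : ℕ) : ℝ) := by
    ext i j
    simp [Matrix.mul_apply, Matrix.vandermonde_apply]
  have hdet := congrArg Matrix.det hmul
  rw [Matrix.det_mul, Matrix.det_vandermonde, Matrix.det_vandermonde] at hdet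
  simp [Fin.prod_univ_succ, Fin.prod_Ioi_succ] at hdet
  rw [leviCivita, eq_div_iff (by norm_num), ← sub_eq_zero]
  linear_combination hdet

end LocalGeometry

/-! ### Pointwise algebra: the Riemann tensor from formal 2-jets. -/

namespace PagePope
open LocalGeometry

/-- The jet of a function of `p 0`. -/
def radialJet (f f₁ f₂ : ℝ) : Jet :=
  ⟨f, ![f₁, 0, 0, 0], ![![f₂, 0, 0, 0], ![0, 0, 0, 0], ![0, 0, 0, 0], ![0, 0, 0, 0]]⟩

/-- The jet of a function of `(p 2, p 3)`. -/
def surfaceJet (f fx fy fxx fxy fyy : ℝ) : Jet :=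
  ⟨f, ![0, 0, fx, fy],
    ![![0, 0, 0, 0], ![0, 0, 0, 0], ![0, 0, fxx, fxy], ![0, 0, fxy, fyy]]⟩

/-- The second order jets at a point of the functions which define a Page–Pope metric. The jet of
`A₂` is determined in part by the equation `∂_x A₂ - ∂_y A₁ = h`. -/
structure PointData where
  (F F₁ F₂ G G₁ G₂ H H₁ H₂ : ℝ)
  (h hx hy hxx hxy hyy : ℝ)
  (A Ax Ay Axx Axy Ayy : ℝ)
  (B By Byy : ℝ)

namespace PointData

variable (D : PointData)

/-- The jets of the components of `dψ + A`. -/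
def etaJet : Fin 4 → Jet :=
  ![Jet.const 0, Jet.const 1, surfaceJet D.A D.Ax D.Ay D.Axx D.Axy D.Ayy,
    surfaceJet D.B (D.h + D.Ay) D.By (D.hx + D.Axy) (D.hy + D.Ayy) D.Byy]

/-- The jets of the components of the metric. -/
def metricJet (c d : Fin 4) : Jet :=
  (((radialJet D.F D.F₁ D.F₂).mul (Jet.const (Matrix.diagonal ![1, 0, 0, 0] c d))).add
    ((radialJet D.G D.G₁ D.G₂).mul ((D.etaJet c).mul (D.etaJet d)))).add
  (((radialJet D.H D.H₁ D.H₂).mul (surfaceJet D.h D.hx D.hy D.hxx D.hxy D.hyy)).mul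
    (Jet.const (Matrix.diagonal ![0, 0, 1, 1] c d)))

/-- The coframe `dr, dψ + A, dx, dy`. -/
def coframe : Fin 4 → Fin 4 → ℝ :=
  ![![1, 0, 0, 0], ![0, 1, D.A, D.B], ![0, 0, 1, 0], ![0, 0, 0, 1]]

/-- The frame dual to `coframe`. -/
def frame : Fin 4 → Fin 4 → ℝ :=
  ![![1, 0, 0, 0], ![0, 1, 0, 0], ![0, -D.A, 1, 0], ![0, -D.B, 0, 1]]

/-- The squared lengths of the coframe. -/
def cosq : Fin 4 → ℝ := ![D.F⁻¹, D.G⁻¹, (D.H * D.h)⁻¹, (D.H * D.h)⁻¹]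

/-- The inverse of the metric. -/
def metricInv (a b : Fin 4) : ℝ := ∑ i, D.cosq i * D.frame i a * D.frame i b

/-- Christoffel symbols of the first kind. -/
def gammaLow (a b c : Fin 4) : ℝ :=
  (1 / 2) * ((D.metricJet a c).d b + (D.metricJet a b).d c - (D.metricJet b c).d a)

/-- Christoffel symbols of the first kind, the first index referring to the frame. -/
def gammaFrame (i b c : Fin 4) : ℝ := ∑ a, D.frame i a * D.gammaLow a b c

/-- The wedge product of two forms of the coframe. -/
def wedge (i j a b : Fin 4) : ℝ := D.coframe i a * D.coframe j b - D.coframe i b * D.coframe j a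

/-- The scalar curvature of the surface. -/
def surfCurv : ℝ := -(D.hxx * D.h - D.hx ^ 2 + (D.hyy * D.h - D.hy ^ 2)) / D.h ^ 3

/-- A tensor of the algebraic type of the curvature of a Page–Pope metric. -/
def curvForm (r₁ r₂ r₃ r₄ r₅ : ℝ) (a b c d : Fin 4) : ℝ :=
  r₁ * (D.wedge 0 1 a b * D.wedge 0 1 c d)
  + r₂ * (D.wedge 2 3 a b * D.wedge 2 3 c d)
  + r₃ * (D.wedge 0 1 a b * D.wedge 2 3 c d + D.wedge 2 3 a b * D.wedge 0 1 c d
    + (D.wedge 0 2 a b * D.wedge 1 3 c d + D.wedge 1 3 a b * D.wedge 0 2 c d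
    - D.wedge 0 3 a b * D.wedge 1 2 c d - D.wedge 1 2 a b * D.wedge 0 3 c d) / 2)
  + r₄ * (D.wedge 0 2 a b * D.wedge 0 2 c d + D.wedge 0 3 a b * D.wedge 0 3 c d)
  + r₅ * (D.wedge 1 2 a b * D.wedge 1 2 c d + D.wedge 1 3 a b * D.wedge 1 3 c d)

/-- Sectional curvature of the plane of `dr` and `dψ + A`, up to normalization. -/
def rm01 : ℝ := -D.G₂ / 2 + D.G₁ ^ 2 / (4 * D.G) + D.F₁ * D.G₁ / (4 * D.F)

/-- Sectional curvature of the plane of `dx` and `dy`, up to normalization. -/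
def rm23 : ℝ := D.h ^ 2 * (D.H * D.surfCurv / 2 - D.H₁ ^ 2 / (4 * D.F) - 3 * D.G / 4)

/-- The component of the curvature which mixes the planes of `dr, dψ + A` and of `dx, dy`. -/
def rm0123 : ℝ := -(D.h / 2) * (D.G₁ - D.G * D.H₁ / D.H)

/-- Sectional curvature of the planes of `dr` and `dx` or `dy`, up to normalization. -/
def rm02 : ℝ := D.h * (-D.H₂ / 2 + D.H₁ ^ 2 / (4 * D.H) + D.F₁ * D.H₁ / (4 * D.F))

/-- Sectional curvature of the planes of `dψ + A` and `dx` or `dy`, up to normalization. -/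
def rm12 : ℝ := D.h * (-D.G₁ * D.H₁ / (4 * D.F) + D.G ^ 2 / (4 * D.H))

/-- The Riemann tensor as an expression in the jets of the metric. -/
def rm (e b c d : Fin 4) : ℝ :=
  (1 / 2) * ((D.metricJet e d).dd c b + (D.metricJet c b).dd d e
      - (D.metricJet d b).dd c e - (D.metricJet e c).dd d b)
    + ∑ i, D.cosq i * (D.gammaFrame i d e * D.gammaFrame i c b
        - D.gammaFrame i c e * D.gammaFrame i d b)

lemma metricJet_symm (c d : Fin 4) : D.metricJet c d = D.metricJet d c := by
  have h1 : ∀ v : Fin 4 → ℝ, Matrix.diagonal v c d = Matrix.diagonal v d c := fun v =>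
    congrFun (congrFun (Matrix.diagonal_transpose v).symm c) d
  have h2 : (D.etaJet c).mul (D.etaJet d) = (D.etaJet d).mul (D.etaJet c) := by
    simp only [Jet.mul, Jet.mk.injEq]
    refine ⟨by ring, by ext; ring, by ext; ring⟩
  simp only [metricJet, h1, h2]

lemma gammaFrame_symm (i b c : Fin 4) : D.gammaFrame i b c = D.gammaFrame i c b := by
  refine Finset.sum_congr rfl fun a _ => ?_
  simp only [gammaLow, D.metricJet_symm b c]
  ring

/-- The value of `gammaFrame`. -/
def gammaTable : Fin 4 → Fin 4 → Fin 4 → ℝ :=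
  ![![![D.F₁ / 2, 0, 0, 0],
      ![0, -D.G₁ / 2, -D.G₁ * D.A / 2, -D.G₁ * D.B / 2],
      ![0, -D.G₁ * D.A / 2, -(D.G₁ * D.A ^ 2 + D.H₁ * D.h) / 2, -D.G₁ * D.A * D.B / 2],
      ![0, -D.G₁ * D.B / 2, -D.G₁ * D.A * D.B / 2, -(D.G₁ * D.B ^ 2 + D.H₁ * D.h) / 2]],
    ![![0, D.G₁ / 2, D.G₁ * D.A / 2, D.G₁ * D.B / 2],
      ![D.G₁ / 2, 0, 0, 0],
      ![D.G₁ * D.A / 2, 0, D.G * D.Ax, D.G * (D.Ay + D.h / 2)],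
      ![D.G₁ * D.B / 2, 0, D.G * (D.Ay + D.h / 2), D.G * D.By]],
    ![![0, 0, D.H₁ * D.h / 2, 0],
      ![0, 0, 0, -D.G * D.h / 2],
      ![D.H₁ * D.h / 2, 0, D.H * D.hx / 2, D.H * D.hy / 2 - D.G * D.h * D.A / 2],
      ![0, -D.G * D.h / 2, D.H * D.hy / 2 - D.G * D.h * D.A / 2,
        -D.H * D.hx / 2 - D.G * D.h * D.B]],
    ![![0, 0, 0, D.H₁ * D.h / 2],
      ![0, 0, D.G * D.h / 2, 0],
      ![0, D.G * D.h / 2, D.G * D.h * D.A - D.H * D.hy / 2,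
        D.H * D.hx / 2 + D.G * D.h * D.B / 2],
      ![D.H₁ * D.h / 2, 0, D.H * D.hx / 2 + D.G * D.h * D.B / 2, D.H * D.hy / 2]]]

set_option maxHeartbeats 2000000 in
-- With the first index in the frame, the inverse metric is diagonal in the quadratic part of the
-- curvature, and the symbols become short enough to tabulate.
lemma gammaFrame_eq (i b c : Fin 4) : D.gammaFrame i b c = D.gammaTable i b c := by
  fin_cases i <;> fin_cases b <;> fin_cases c <;>
  simp [gammaFrame, gammaTable, frame, gammaLow, metricJet, Fin.sum_univ_four, Jet.add, Jet.mul,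
    Jet.const, radialJet, surfaceJet, etaJet, Matrix.diagonal] <;> ring

lemma wedge_symm (i j a b : Fin 4) : D.wedge i j b a = -D.wedge i j a b := by
  simp only [wedge]; ring

lemma curvForm_antisymm_left (r₁ r₂ r₃ r₄ r₅ : ℝ) (a b c d : Fin 4) :
    D.curvForm r₁ r₂ r₃ r₄ r₅ b a c d = -D.curvForm r₁ r₂ r₃ r₄ r₅ a b c d := by
  simp only [curvForm, D.wedge_symm _ _ a b]; ring

lemma curvForm_antisymm_right (r₁ r₂ r₃ r₄ r₅ : ℝ) (a b c d : Fin 4) :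
    D.curvForm r₁ r₂ r₃ r₄ r₅ a b d c = -D.curvForm r₁ r₂ r₃ r₄ r₅ a b c d := by
  simp only [curvForm, D.wedge_symm _ _ c d]; ring

lemma rm_antisymm_left (a b c d : Fin 4) : D.rm b a c d = -D.rm a b c d := by
  simp only [rm, D.metricJet_symm _ a, D.metricJet_symm _ b, Fin.sum_univ_four,
    D.gammaFrame_symm _ _ a, D.gammaFrame_symm _ _ b]
  ring

lemma rm_antisymm_right (a b c d : Fin 4) : D.rm a b d c = -D.rm a b c d := by
  simp only [rm, Fin.sum_univ_four]
  ring

set_option maxHeartbeats 4000000 in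
-- A rational identity for each pair of increasing index pairs. The potential enters the result only
-- through the coframe and through `dA`, which is `h dx ∧ dy` by the form of `etaJet`. The factor
-- 1/2 in the mixed part of `curvForm` is the one required by the first Bianchi identity.
lemma rm_eq (hF : D.F ≠ 0) (hG : D.G ≠ 0) (hH : D.H ≠ 0) (hh : D.h ≠ 0) (a b c d : Fin 4) :
    D.rm a b c d = D.curvForm D.rm01 D.rm23 D.rm0123 D.rm02 D.rm12 a b c d := by
  refine eq_of_antisymm D.rm_antisymm_left D.rm_antisymm_right
    (D.curvForm_antisymm_left _ _ _ _ _) (D.curvForm_antisymm_right _ _ _ _ _) ?_ a b c d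
  clear a b c d
  intro a b c d hab hcd
  fin_cases a <;> fin_cases b <;> first | (exfalso; revert hab; decide) | skip
  all_goals fin_cases c <;> fin_cases d <;> first | (exfalso; revert hcd; decide) | skip
  all_goals
    simp [rm, gammaFrame_eq, gammaTable, cosq, curvForm, wedge, coframe, metricJet,
      Fin.sum_univ_four, Jet.add, Jet.mul, Jet.const, radialJet, surfaceJet, etaJet,
      Matrix.diagonal, rm01, rm23, rm0123, rm02, rm12, surfCurv, hF]
    try field_simp
    try ring

/-! ### Contractions and the Weyl tensor -/

/-- The matrix of the metric. -/
def metricVal (a b : Fin 4) : ℝ :=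
  D.F * (D.coframe 0 a * D.coframe 0 b) + D.G * (D.coframe 1 a * D.coframe 1 b)
    + D.H * D.h * (D.coframe 2 a * D.coframe 2 b + D.coframe 3 a * D.coframe 3 b)

lemma sum_metricInv_mul_coframe (a i : Fin 4) :
    ∑ e, D.metricInv a e * D.coframe i e = D.cosq i * D.frame i a := by
  fin_cases i <;> fin_cases a <;>
    simp [metricInv, coframe, frame, cosq, Fin.sum_univ_four] <;> ring

lemma sum_frame_mul_coframe (i j : Fin 4) :
    ∑ a, D.frame i a * D.coframe j a = if i = j then 1 else 0 := by
  fin_cases i <;> fin_cases j <;> simp [coframe, frame, Fin.sum_univ_four]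

lemma sum_metricInv_mul_coframe_mul_coframe (i j : Fin 4) :
    ∑ a, ∑ e, D.metricInv a e * (D.coframe i e * D.coframe j a) =
      if i = j then D.cosq i else 0 := by
  have : ∀ a, ∑ e, D.metricInv a e * (D.coframe i e * D.coframe j a)
      = D.cosq i * (D.frame i a * D.coframe j a) := fun a => by
    rw [← mul_assoc, ← sum_metricInv_mul_coframe, Finset.sum_mul]
    exact Finset.sum_congr rfl fun _ _ => by ring
  simp only [this, ← Finset.mul_sum, sum_frame_mul_coframe, mul_ite, mul_one, mul_zero]

/-- A diagonal symmetric 2-tensor. -/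
def diagForm (ρ₀ ρ₁ ρ₂ : ℝ) (b d : Fin 4) : ℝ :=
  ρ₀ * (D.coframe 0 b * D.coframe 0 d) + ρ₁ * (D.coframe 1 b * D.coframe 1 d)
    + ρ₂ * (D.coframe 2 b * D.coframe 2 d + D.coframe 3 b * D.coframe 3 d)

/-- Contraction of two wedge products. -/
lemma sum_metricInv_mul_wedge (i j k l b d : Fin 4) :
    ∑ a, ∑ e, D.metricInv a e * (D.wedge i j e b * D.wedge k l a d)
      = (if i = k then D.cosq i else 0) * (D.coframe j b * D.coframe l d)
        - (if i = l then D.cosq i else 0) * (D.coframe j b * D.coframe k d)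
        - (if j = k then D.cosq j else 0) * (D.coframe i b * D.coframe l d)
        + (if j = l then D.cosq j else 0) * (D.coframe i b * D.coframe k d) := by
  simp only [← sum_metricInv_mul_coframe_mul_coframe, Finset.sum_mul,
    ← Finset.sum_sub_distrib, ← Finset.sum_add_distrib, wedge]
  exact Finset.sum_congr rfl fun _ _ => Finset.sum_congr rfl fun _ _ => by ring

/-- A sum of scalar multiples of products of wedges, so that contraction and Hodge star can be
applied term by term. -/
lemma curvForm_eq (r₁ r₂ r₃ r₄ r₅ : ℝ) (a b c d : Fin 4) :
    D.curvForm r₁ r₂ r₃ r₄ r₅ a b c d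
      = r₁ * (D.wedge 0 1 a b * D.wedge 0 1 c d) + r₂ * (D.wedge 2 3 a b * D.wedge 2 3 c d)
        + r₃ * (D.wedge 0 1 a b * D.wedge 2 3 c d) + r₃ * (D.wedge 2 3 a b * D.wedge 0 1 c d)
        + r₃ / 2 * (D.wedge 0 2 a b * D.wedge 1 3 c d)
        + r₃ / 2 * (D.wedge 1 3 a b * D.wedge 0 2 c d)
        + -r₃ / 2 * (D.wedge 0 3 a b * D.wedge 1 2 c d)
        + -r₃ / 2 * (D.wedge 1 2 a b * D.wedge 0 3 c d)
        + r₄ * (D.wedge 0 2 a b * D.wedge 0 2 c d) + r₄ * (D.wedge 0 3 a b * D.wedge 0 3 c d)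
        + r₅ * (D.wedge 1 2 a b * D.wedge 1 2 c d) + r₅ * (D.wedge 1 3 a b * D.wedge 1 3 c d) := by
  simp only [curvForm]
  ring

/-- Dividing by squared lengths makes the `k`'s sectional curvatures in an orthonormal frame. The
mixed part pairs planes without a common coframe vector, so it has no trace. -/
lemma ricci_curvForm (k₁ k₂ r₃ k₄ k₅ : ℝ)
    (hF : D.F ≠ 0) (hG : D.G ≠ 0) (hH : D.H ≠ 0) (hh : D.h ≠ 0) (b d : Fin 4) :
    ∑ a, ∑ e, D.metricInv a e * D.curvForm (k₁ * (D.F * D.G)) (k₂ * (D.H * D.h) ^ 2) r₃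
        (k₄ * (D.F * (D.H * D.h))) (k₅ * (D.G * (D.H * D.h))) e b a d
      = D.diagForm (D.F * (k₁ + 2 * k₄)) (D.G * (k₁ + 2 * k₅))
          (D.H * D.h * (k₂ + k₄ + k₅)) b d := by
  have hc : ∀ (i j k l : Fin 4) (r : ℝ),
      ∑ a, ∑ e, D.metricInv a e * (r * (D.wedge i j e b * D.wedge k l a d))
        = r * ∑ a, ∑ e, D.metricInv a e * (D.wedge i j e b * D.wedge k l a d) := by
    intro i j k l r
    simp only [Finset.mul_sum]
    exact Finset.sum_congr rfl fun _ _ => Finset.sum_congr rfl fun _ _ => by ring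
  simp only [curvForm_eq, mul_add, Finset.sum_add_distrib, hc, sum_metricInv_mul_wedge]
  simp [cosq, diagForm]
  field_simp
  ring

lemma scalar_diagForm (ρ₀ ρ₁ ρ₂ : ℝ)
    (hF : D.F ≠ 0) (hG : D.G ≠ 0) (hH : D.H ≠ 0) (hh : D.h ≠ 0) :
    ∑ a, ∑ b, D.metricInv a b * D.diagForm (D.F * ρ₀) (D.G * ρ₁) (D.H * D.h * ρ₂) a b
      = ρ₀ + ρ₁ + 2 * ρ₂ := by
  simp [diagForm, metricInv, coframe, frame, cosq, Fin.sum_univ_four]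
  field_simp
  ring

/-- Vanishing of the three Ricci entries forces the even coefficients into the ratio `1 : 1 : -1/2 :
-1/2`, so one scalar survives; the mixed part is already trace-free. -/
lemma weyl_curvForm (k₁ k₂ r₃ k₄ k₅ : ℝ) (a b c d : Fin 4) :
    D.curvForm (k₁ * (D.F * D.G)) (k₂ * (D.H * D.h) ^ 2) r₃
        (k₄ * (D.F * (D.H * D.h))) (k₅ * (D.G * (D.H * D.h))) a b c d
      - (1 / 2) * (D.metricVal a c * D.diagForm (D.F * (k₁ + 2 * k₄)) (D.G * (k₁ + 2 * k₅))
            (D.H * D.h * (k₂ + k₄ + k₅)) b d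
          - D.metricVal a d * D.diagForm (D.F * (k₁ + 2 * k₄)) (D.G * (k₁ + 2 * k₅))
            (D.H * D.h * (k₂ + k₄ + k₅)) b c
          - D.metricVal b c * D.diagForm (D.F * (k₁ + 2 * k₄)) (D.G * (k₁ + 2 * k₅))
            (D.H * D.h * (k₂ + k₄ + k₅)) a d
          + D.metricVal b d * D.diagForm (D.F * (k₁ + 2 * k₄)) (D.G * (k₁ + 2 * k₅))
            (D.H * D.h * (k₂ + k₄ + k₅)) a c)
      + ((k₁ + 2 * k₄) + (k₁ + 2 * k₅) + 2 * (k₂ + k₄ + k₅)) / 6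
        * (D.metricVal a c * D.metricVal b d - D.metricVal a d * D.metricVal b c)
      = D.curvForm ((k₁ + k₂ - k₄ - k₅) / 3 * (D.F * D.G))
          ((k₁ + k₂ - k₄ - k₅) / 3 * (D.H * D.h) ^ 2) r₃
          (-((k₁ + k₂ - k₄ - k₅) / 6) * (D.F * (D.H * D.h)))
          (-((k₁ + k₂ - k₄ - k₅) / 6) * (D.G * (D.H * D.h))) a b c d := by
  simp only [curvForm, diagForm, metricVal, wedge]
  ring

/-! ### Hodge star on the coframe and on the Weyl tensor. -/

/-- The Hodge dual of a 2-form, with volume form `√(det g) = v`. -/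
def star (v : ℝ) (X : Fin 4 → Fin 4 → ℝ) (a b : Fin 4) : ℝ :=
  (1 / 2) * ∑ e, ∑ f, (∑ k, ∑ l, v * leviCivita a b k l * D.metricInv k e * D.metricInv l f) * X e f

/-- Raising both indices of a wedge of coframe elements gives the dual frame bivector, scaled by the
squared lengths. -/
lemma star_wedge (v : ℝ) (i j a b : Fin 4) :
    D.star v (D.wedge i j) a b = v * D.cosq i * D.cosq j *
      ((1 / 2) * ∑ k, ∑ l, leviCivita a b k l *
        (D.frame i k * D.frame j l - D.frame j k * D.frame i l)) := by
  have h1 : ∀ k l, ∑ e, ∑ f, D.metricInv k e * D.metricInv l f * D.wedge i j e f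
      = D.cosq i * D.cosq j * (D.frame i k * D.frame j l - D.frame j k * D.frame i l) := by
    intro k l
    have h2 : ∀ i j, ∑ e, ∑ f, D.metricInv k e * D.metricInv l f * (D.coframe i e * D.coframe j f)
        = D.cosq i * D.frame i k * (D.cosq j * D.frame j l) := by
      intro i j
      rw [← sum_metricInv_mul_coframe, ← sum_metricInv_mul_coframe, Finset.sum_mul_sum]
      exact Finset.sum_congr rfl fun _ _ => Finset.sum_congr rfl fun _ _ => by ring
    have h3 : ∀ e f, D.wedge i j e f
        = D.coframe i e * D.coframe j f - D.coframe j e * D.coframe i f := fun e f => by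
      simp only [wedge]; ring
    simp only [h3, mul_sub, Finset.sum_sub_distrib, h2]
    ring
  have h4 : ∑ e, ∑ f, (∑ k, ∑ l, v * leviCivita a b k l * D.metricInv k e * D.metricInv l f)
        * D.wedge i j e f
      = ∑ k, ∑ l, v * leviCivita a b k l *
        ∑ e, ∑ f, D.metricInv k e * D.metricInv l f * D.wedge i j e f := by
    simp only [Fin.sum_univ_four]
    ring
  rw [star, h4]
  simp only [h1, Finset.mul_sum]
  exact Finset.sum_congr rfl fun _ _ => Finset.sum_congr rfl fun _ _ => by ring

lemma star_add (v : ℝ) (X Y : Fin 4 → Fin 4 → ℝ) (a b : Fin 4) :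
    D.star v (fun e f => X e f + Y e f) a b = D.star v X a b + D.star v Y a b := by
  simp only [star, mul_add, Finset.sum_add_distrib]

lemma star_mul_mul (v r t : ℝ) (X : Fin 4 → Fin 4 → ℝ) (a b : Fin 4) :
    D.star v (fun e f => r * (X e f * t)) a b = r * (D.star v X a b * t) := by
  have : ∀ y : ℝ, r * ((1 / 2) * y * t) = (1 / 2) * (y * (r * t)) := fun y => by ring
  simp only [star, this, Finset.sum_mul]
  congr 1
  refine Finset.sum_congr rfl fun _ _ => Finset.sum_congr rfl fun _ _ => ?_
  simp only [← Finset.sum_mul]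
  ring

set_option maxHeartbeats 1000000 in
lemma star_wedge_basis (v : ℝ) (a b : Fin 4) :
    D.star v (D.wedge 0 1) a b = v * D.cosq 0 * D.cosq 1 * D.wedge 2 3 a b ∧
    D.star v (D.wedge 2 3) a b = v * D.cosq 2 * D.cosq 3 * D.wedge 0 1 a b ∧
    D.star v (D.wedge 0 2) a b = v * D.cosq 0 * D.cosq 2 * -D.wedge 1 3 a b ∧
    D.star v (D.wedge 1 3) a b = v * D.cosq 1 * D.cosq 3 * -D.wedge 0 2 a b ∧
    D.star v (D.wedge 0 3) a b = v * D.cosq 0 * D.cosq 3 * D.wedge 1 2 a b ∧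
    D.star v (D.wedge 1 2) a b = v * D.cosq 1 * D.cosq 2 * D.wedge 0 3 a b := by
  simp only [star_wedge]
  refine ⟨?_, ?_, ?_, ?_, ?_, ?_⟩ <;> congr 1 <;> fin_cases a <;> fin_cases b <;>
    simp [leviCivita_eq, Fin.sum_univ_four, frame, coframe, wedge] <;> ring

/-- A tensor of the algebraic type of the Weyl tensor of a Page–Pope metric. -/
def weylForm (u m : ℝ) (a b c d : Fin 4) : ℝ :=
  D.curvForm (u * (D.F * D.G)) (u * (D.H * D.h) ^ 2) m
    (-(u / 2) * (D.F * (D.H * D.h))) (-(u / 2) * (D.G * (D.H * D.h))) a b c d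

lemma weylForm_mul (r u m : ℝ) (a b c d : Fin 4) :
    D.weylForm (r * u) (r * m) a b c d = r * D.weylForm u m a b c d := by
  simp only [weylForm, curvForm]
  ring

lemma weylForm_0101 (u m : ℝ) : D.weylForm u m 0 1 0 1 = u * (D.F * D.G) := by
  simp [weylForm, curvForm, wedge, coframe]

/-- The star exchanges complementary planes, so diagonal terms become mixed ones and conversely. The
result has the same type because the ratio `-1/2` from trace-freeness, with the sign of the star on
the planes 02 and 13, matches the ratio `1/2` from the Bianchi identity. -/
lemma star_weylForm {σ : ℝ} (hF : D.F ≠ 0) (hG : D.G ≠ 0) (hH : D.H ≠ 0) (hh : D.h ≠ 0)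
    (hσ : σ ^ 2 = D.F * D.G) (u m : ℝ) (a b c d : Fin 4) :
    D.star (σ * (D.H * D.h)) (fun e f => D.weylForm u m e f c d) a b
      = D.weylForm (m / (σ * (D.H * D.h))) (u * (σ * (D.H * D.h))) a b c d := by
  obtain ⟨h1, h2, h3, h4, h5, h6⟩ := D.star_wedge_basis (σ * (D.H * D.h)) a b
  have hσ0 : σ ≠ 0 := by
    rintro rfl
    exact mul_ne_zero hF hG (by simpa using hσ.symm)
  have hG' : D.G = σ ^ 2 / D.F := by rw [hσ]; field_simp
  simp only [weylForm, curvForm_eq, star_add, star_mul_mul, h1, h2, h3, h4, h5, h6]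
  simp only [cosq, Matrix.cons_val, hG']
  field_simp
  ring

end PointData

/-! ### Jets of the functions of a Page–Pope metric -/

lemma pd_radial {f : ℝ → ℝ} {p : Fin 4 → ℝ} (hf : DifferentiableAt ℝ f (p 0)) (a : Fin 4) :
    pd a (fun q => f (q 0)) p = deriv f (p 0) * (Pi.single a 1 : Fin 4 → ℝ) 0 := by
  have h1 : HasFDerivAt (fun q : Fin 4 → ℝ => q 0)
      (ContinuousLinearMap.proj (R := ℝ) (φ := fun _ : Fin 4 => ℝ) 0) p :=
    hasFDerivAt_apply 0 p
  have h2 := hf.hasDerivAt.comp_hasFDerivAt p h1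
  have h3 : fderiv ℝ (fun q : Fin 4 → ℝ => f (q 0)) p = _ := h2.fderiv
  simp [pd, h3]

lemma pd_surface {f : ℝ × ℝ → ℝ} {p : Fin 4 → ℝ} (hf : DifferentiableAt ℝ f (p 2, p 3))
    (a : Fin 4) : pd a (fun q => f (q 2, q 3)) p
      = (Pi.single a 1 : Fin 4 → ℝ) 2 * dX f (p 2, p 3)
        + (Pi.single a 1 : Fin 4 → ℝ) 3 * dY f (p 2, p 3) := by
  have h1 : HasFDerivAt (fun q : Fin 4 → ℝ => (q 2, q 3))
      ((ContinuousLinearMap.proj (R := ℝ) (φ := fun _ : Fin 4 => ℝ) 2).prod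
        (ContinuousLinearMap.proj (R := ℝ) (φ := fun _ : Fin 4 => ℝ) 3)) p :=
    (hasFDerivAt_apply 2 p).prodMk (hasFDerivAt_apply 3 p)
  have h2 : HasFDerivAt (fun q : Fin 4 → ℝ => f (q 2, q 3)) _ p :=
    HasFDerivAt.comp p (f := fun q : Fin 4 → ℝ => (q 2, q 3)) hf.hasFDerivAt h1
  have h4 : ∀ x y : ℝ, ((x, y) : ℝ × ℝ) = x • (1, 0) + y • (0, 1) := fun x y => by simp
  rw [pd, h2.fderiv]
  simp only [ContinuousLinearMap.comp_apply, ContinuousLinearMap.prod_apply,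
    ContinuousLinearMap.proj_apply]
  rw [h4 ((Pi.single a 1 : Fin 4 → ℝ) 2) ((Pi.single a 1 : Fin 4 → ℝ) 3), map_add, map_smul,
    map_smul]
  rfl

lemma contDiffAt_deriv {f : ℝ → ℝ} {x : ℝ} (hf : ContDiffAt ℝ ∞ f x) :
    ContDiffAt ℝ ∞ (deriv f) x :=
  (hf.fderiv_right (m := ∞) (by simp)).clm_apply contDiffAt_const

lemma hasJet_radial {f : ℝ → ℝ} {p : Fin 4 → ℝ} (hf : ContDiffAt ℝ ∞ f (p 0)) :
    HasJet (fun q => f (q 0)) p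
      (radialJet (f (p 0)) (deriv f (p 0)) (deriv (deriv f) (p 0))) := by
  have h0 : ContinuousAt (fun q : Fin 4 → ℝ => q 0) p := (continuous_apply 0).continuousAt
  have hdiff : ∀ᶠ x in nhds (p 0), DifferentiableAt ℝ f x :=
    ((hf.of_le (m := 1) (by simp)).eventually (by simp)).mono
      fun _ h => h.differentiableAt (by norm_num)
  have hd' := (contDiffAt_deriv hf).differentiableAt (by simp)
  refine ⟨?_, rfl, fun a => ?_, fun a b => ?_⟩
  · exact ContDiffAt.comp p (f := fun q : Fin 4 → ℝ => q 0)
      (hf.of_le ENat.LEInfty.out) (contDiff_apply ℝ ℝ 0).contDiffAt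
  · rw [pd_radial hdiff.self_of_nhds]
    fin_cases a <;> simp [radialJet]
  · have hev : pd b (fun q => f (q 0)) =ᶠ[nhds p]
        fun q => deriv f (q 0) * (Pi.single b 1 : Fin 4 → ℝ) 0 := by
      filter_upwards [h0.eventually hdiff] with q hq
      exact pd_radial hq b
    have hd3 : DifferentiableAt ℝ (fun q : Fin 4 → ℝ => deriv f (q 0)) p :=
      DifferentiableAt.comp p (f := fun q : Fin 4 → ℝ => q 0) hd' (differentiableAt_apply 0 p)
    rw [pd_congr hev, pd_mul hd3 (differentiableAt_const _), pd_radial hd']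
    fin_cases a <;> fin_cases b <;> simp [radialJet, pd]

lemma contDiffAt_surface {f : ℝ × ℝ → ℝ} {p : Fin 4 → ℝ} {n : WithTop ℕ∞}
    (hf : ContDiffAt ℝ n f (p 2, p 3)) : ContDiffAt ℝ n (fun q : Fin 4 → ℝ => f (q 2, q 3)) p :=
  ContDiffAt.comp p (f := fun q : Fin 4 → ℝ => (q 2, q 3)) hf
    ((contDiff_apply ℝ ℝ 2).contDiffAt.prodMk (contDiff_apply ℝ ℝ 3).contDiffAt)

lemma contDiffAt_dX {f : ℝ × ℝ → ℝ} {q : ℝ × ℝ} (hf : ContDiffAt ℝ ∞ f q) :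
    ContDiffAt ℝ ∞ (dX f) q :=
  (hf.fderiv_right (m := ∞) (by simp)).clm_apply contDiffAt_const

lemma contDiffAt_dY {f : ℝ × ℝ → ℝ} {q : ℝ × ℝ} (hf : ContDiffAt ℝ ∞ f q) :
    ContDiffAt ℝ ∞ (dY f) q :=
  (hf.fderiv_right (m := ∞) (by simp)).clm_apply contDiffAt_const

lemma pd_pd_surface {f : ℝ × ℝ → ℝ} {p : Fin 4 → ℝ} (hf : ContDiffAt ℝ ∞ f (p 2, p 3))
    (a b : Fin 4) : pd a (pd b fun q => f (q 2, q 3)) p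
      = (Pi.single b 1 : Fin 4 → ℝ) 2 * ((Pi.single a 1 : Fin 4 → ℝ) 2 * dX (dX f) (p 2, p 3)
          + (Pi.single a 1 : Fin 4 → ℝ) 3 * dY (dX f) (p 2, p 3))
        + (Pi.single b 1 : Fin 4 → ℝ) 3 * ((Pi.single a 1 : Fin 4 → ℝ) 2 * dX (dY f) (p 2, p 3)
          + (Pi.single a 1 : Fin 4 → ℝ) 3 * dY (dY f) (p 2, p 3)) := by
  have h0 : ContinuousAt (fun q : Fin 4 → ℝ => (q 2, q 3)) p :=
    ((continuous_apply 2).prodMk (continuous_apply 3)).continuousAt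
  have hdiff : ∀ᶠ x in nhds (p 2, p 3), DifferentiableAt ℝ f x :=
    ((hf.of_le (m := 1) (by simp)).eventually (by simp)).mono
      fun _ h => h.differentiableAt (by norm_num)
  have hev : pd b (fun q => f (q 2, q 3)) =ᶠ[nhds p]
      fun q => (Pi.single b 1 : Fin 4 → ℝ) 2 * dX f (q 2, q 3)
        + (Pi.single b 1 : Fin 4 → ℝ) 3 * dY f (q 2, q 3) := by
    filter_upwards [h0.eventually hdiff] with q hq
    exact pd_surface hq b
  have hX := contDiffAt_dX hf
  have hY := contDiffAt_dY hf
  have hX' := (contDiffAt_surface hX).differentiableAt (by simp)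
  have hY' := (contDiffAt_surface hY).differentiableAt (by simp)
  rw [pd_congr hev, pd_add (hX'.const_mul _) (hY'.const_mul _), pd_const_mul hX',
    pd_const_mul hY', pd_surface (hX.differentiableAt (by simp)),
    pd_surface (hY.differentiableAt (by simp))]

/-- Regards the surface point as the last two coordinates of a point of `ℝ⁴`, where symmetry of
second derivatives is known. -/
lemma dY_dX_eq {f : ℝ × ℝ → ℝ} {q : ℝ × ℝ} (hf : ContDiffAt ℝ ∞ f q) :
    dY (dX f) q = dX (dY f) q := by
  have hf' : ContDiffAt ℝ ∞ f
      ((![0, 0, q.1, q.2] : Fin 4 → ℝ) 2, (![0, 0, q.1, q.2] : Fin 4 → ℝ) 3) := by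
    simpa using hf
  have h := pd_comm ((contDiffAt_surface hf').of_le ENat.LEInfty.out) 3 2
  rw [pd_pd_surface hf', pd_pd_surface hf'] at h
  simpa using h

lemma hasJet_surface {f : ℝ × ℝ → ℝ} {p : Fin 4 → ℝ} (hf : ContDiffAt ℝ ∞ f (p 2, p 3)) :
    HasJet (fun q => f (q 2, q 3)) p
      (surfaceJet (f (p 2, p 3)) (dX f (p 2, p 3)) (dY f (p 2, p 3)) (dX (dX f) (p 2, p 3))
        (dX (dY f) (p 2, p 3)) (dY (dY f) (p 2, p 3))) := by
  refine ⟨(contDiffAt_surface hf).of_le ENat.LEInfty.out, rfl, fun a => ?_,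
    fun a b => ?_⟩
  · rw [pd_surface (hf.differentiableAt (by simp))]
    fin_cases a <;> simp [surfaceJet]
  · rw [pd_pd_surface hf, dY_dX_eq hf]
    fin_cases a <;> fin_cases b <;> simp [surfaceJet]

/-- The jets at `p` of the functions which define a Page–Pope metric. -/
def pointData (F G H : ℝ → ℝ) (h A₁ A₂ : ℝ × ℝ → ℝ) (p : Fin 4 → ℝ) : PointData where
  F := F (p 0)
  F₁ := deriv F (p 0)
  F₂ := deriv (deriv F) (p 0)
  G := G (p 0)
  G₁ := deriv G (p 0)
  G₂ := deriv (deriv G) (p 0)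
  H := H (p 0)
  H₁ := deriv H (p 0)
  H₂ := deriv (deriv H) (p 0)
  h := h (p 2, p 3)
  hx := dX h (p 2, p 3)
  hy := dY h (p 2, p 3)
  hxx := dX (dX h) (p 2, p 3)
  hxy := dX (dY h) (p 2, p 3)
  hyy := dY (dY h) (p 2, p 3)
  A := A₁ (p 2, p 3)
  Ax := dX A₁ (p 2, p 3)
  Ay := dY A₁ (p 2, p 3)
  Axx := dX (dX A₁) (p 2, p 3)
  Axy := dX (dY A₁) (p 2, p 3)
  Ayy := dY (dY A₁) (p 2, p 3)
  B := A₂ (p 2, p 3)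
  By := dY A₂ (p 2, p 3)
  Byy := dY (dY A₂) (p 2, p 3)

lemma metric_apply (F G H : ℝ → ℝ) (h A₁ A₂ : ℝ × ℝ → ℝ) (p : Fin 4 → ℝ) (c d : Fin 4) :
    metric F G H h A₁ A₂ p c d
      = F (p 0) * Matrix.diagonal ![1, 0, 0, 0] c d
        + G (p 0) * (connectionForm A₁ A₂ p c * connectionForm A₁ A₂ p d)
        + H (p 0) * h (p 2, p 3) * Matrix.diagonal ![0, 0, 1, 1] c d := by
  simp [metric, Matrix.vecMulVec_apply]

lemma metric_symm (F G H : ℝ → ℝ) (h A₁ A₂ : ℝ × ℝ → ℝ) (p : Fin 4 → ℝ) (c d : Fin 4) :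
    metric F G H h A₁ A₂ p c d = metric F G H h A₁ A₂ p d c := by
  have h1 : ∀ v : Fin 4 → ℝ, Matrix.diagonal v c d = Matrix.diagonal v d c := fun v =>
    congrFun (congrFun (Matrix.diagonal_transpose v).symm c) d
  rw [metric_apply, metric_apply, h1, h1]
  ring

section

variable {F G H : ℝ → ℝ} {h A₁ A₂ : ℝ × ℝ → ℝ} {p : Fin 4 → ℝ}

/-- The equation `dA = h dx ∧ dy` and its first derivatives eliminate `∂_x A₂`, `∂_x² A₂` and `∂_x
∂_y A₂`; differentiating it requires that it hold near the point. -/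
lemma hasJet_eta (hh : ContDiffAt ℝ ∞ h (p 2, p 3))
    (hA₁ : ContDiffAt ℝ ∞ A₁ (p 2, p 3)) (hA₂ : ContDiffAt ℝ ∞ A₂ (p 2, p 3))
    (hdA : ∀ᶠ q in nhds (p 2, p 3), dX A₂ q - dY A₁ q = h q) (c : Fin 4) :
    HasJet (fun q => connectionForm A₁ A₂ q c) p ((pointData F G H h A₁ A₂ p).etaJet c) := by
  fin_cases c
  · exact HasJet.const 0 p
  · exact HasJet.const 1 p
  · exact hasJet_surface hA₁
  · have hev : dX A₂ =ᶠ[nhds (p 2, p 3)] fun q => h q + dY A₁ q := by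
      filter_upwards [hdA] with q hq
      linarith
    have hh1 := hh.differentiableAt (by simp)
    have hA1 := (contDiffAt_dY hA₁).differentiableAt (by simp)
    have e1 : dX A₂ (p 2, p 3) = h (p 2, p 3) + dY A₁ (p 2, p 3) := hev.self_of_nhds
    have e2 : dX (dX A₂) (p 2, p 3) = dX h (p 2, p 3) + dX (dY A₁) (p 2, p 3) := by
      rw [dX, hev.fderiv_eq, fderiv_fun_add hh1 hA1]; rfl
    have e3 : dX (dY A₂) (p 2, p 3) = dY h (p 2, p 3) + dY (dY A₁) (p 2, p 3) := by
      rw [← dY_dX_eq hA₂, dY, hev.fderiv_eq, fderiv_fun_add hh1 hA1]; rfl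
    have hj := hasJet_surface hA₂
    rw [e1, e2, e3] at hj
    exact hj

lemma hasJet_metric (hF : ContDiffAt ℝ ∞ F (p 0)) (hG : ContDiffAt ℝ ∞ G (p 0))
    (hH : ContDiffAt ℝ ∞ H (p 0)) (hh : ContDiffAt ℝ ∞ h (p 2, p 3))
    (hA₁ : ContDiffAt ℝ ∞ A₁ (p 2, p 3)) (hA₂ : ContDiffAt ℝ ∞ A₂ (p 2, p 3))
    (hdA : ∀ᶠ q in nhds (p 2, p 3), dX A₂ q - dY A₁ q = h q) (c d : Fin 4) :
    HasJet (fun q => metric F G H h A₁ A₂ q c d) p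
      ((pointData F G H h A₁ A₂ p).metricJet c d) := by
  simp only [metric_apply]
  exact (((hasJet_radial hF).mul (HasJet.const _ p)).add ((hasJet_radial hG).mul
    ((hasJet_eta hh hA₁ hA₂ hdA c).mul (hasJet_eta hh hA₁ hA₂ hdA d)))).add
      (((hasJet_radial hH).mul (hasJet_surface hh)).mul (HasJet.const _ p))

lemma metric_eq_metricVal (c d : Fin 4) : metric F G H h A₁ A₂ p c d
    = (pointData F G H h A₁ A₂ p).metricVal c d := by
  rw [metric_apply]
  fin_cases c <;> fin_cases d <;>
    simp [PointData.metricVal, PointData.coframe, pointData, connectionForm, Matrix.diagonal]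

lemma det_metric : (metric F G H h A₁ A₂ p).det
    = F (p 0) * G (p 0) * (H (p 0) * h (p 2, p 3)) ^ 2 := by
  simp [Matrix.det_succ_row_zero, Fin.sum_univ_succ, Fin.succAbove, metric_eq_metricVal,
    PointData.metricVal, PointData.coframe, pointData]
  ring

lemma inv_metric (hF : F (p 0) ≠ 0) (hG : G (p 0) ≠ 0) (hH : H (p 0) ≠ 0)
    (hh : h (p 2, p 3) ≠ 0) (a b : Fin 4) : (metric F G H h A₁ A₂ p)⁻¹ a b
      = (pointData F G H h A₁ A₂ p).metricInv a b := by
  have : (metric F G H h A₁ A₂ p)⁻¹ = Matrix.of (pointData F G H h A₁ A₂ p).metricInv := by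
    apply Matrix.inv_eq_right_inv
    ext i j
    rw [Matrix.mul_apply]
    simp only [metric_eq_metricVal, Matrix.of_apply, PointData.metricVal,
      PointData.metricInv, PointData.cosq, PointData.frame, PointData.coframe, pointData]
    fin_cases i <;> fin_cases j <;> simp [Fin.sum_univ_four] <;> field_simp <;> ring
  rw [this]; rfl

end

/-! ### The curvature of a Page–Pope metric -/

namespace PointData

variable (D : PointData)

/-- The scalar which determines the even part of the Weyl tensor. -/
def weylEven : ℝ :=
  (D.rm01 / (D.F * D.G) + D.rm23 / (D.H * D.h) ^ 2 - D.rm02 / (D.F * (D.H * D.h))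
    - D.rm12 / (D.G * (D.H * D.h))) / 3

/-- The derivative of `G / H` with respect to `r`. -/
def ratio₁ : ℝ := (D.G₁ * D.H - D.G * D.H₁) / D.H ^ 2

/-- The second derivative of `G / H` with respect to a primitive of `√(F G) / H`. -/
def ratio₂ : ℝ :=
  D.H ^ 2 / (D.F * D.G) * (D.G₂ / D.H - 2 * D.G₁ * D.H₁ / D.H ^ 2 - D.G * D.H₂ / D.H ^ 2
    + 2 * D.G * D.H₁ ^ 2 / D.H ^ 3)
  + (D.H * D.H₁ / (D.F * D.G) - D.H ^ 2 * (D.F₁ * D.G + D.F * D.G₁) / (2 * (D.F * D.G) ^ 2))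
    * D.ratio₁

/-- Apart from the conformal weight `1/H`, only `y = G/H`, its second derivative in `z` and the
surface curvature remain. -/
lemma weylEven_eq (hF : D.F ≠ 0) (hG : D.G ≠ 0) (hH : D.H ≠ 0) (hh : D.h ≠ 0) :
    D.weylEven = -(D.ratio₂ + 2 * (D.G / D.H) - D.surfCurv) / (6 * D.H) := by
  simp only [weylEven, rm01, rm23, rm02, rm12, ratio₁, ratio₂]
  field_simp
  ring

lemma rm0123_eq (hH : D.H ≠ 0) : D.rm0123 = -(D.h * D.H / 2) * D.ratio₁ := by
  simp only [rm0123, ratio₁]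
  field_simp

end PointData

section

variable {F G H : ℝ → ℝ} {h A₁ A₂ : ℝ × ℝ → ℝ} {p : Fin 4 → ℝ}

lemma riemann_metric (hF : ContDiffAt ℝ ∞ F (p 0)) (hG : ContDiffAt ℝ ∞ G (p 0))
    (hH : ContDiffAt ℝ ∞ H (p 0)) (hh : ContDiffAt ℝ ∞ h (p 2, p 3))
    (hA₁ : ContDiffAt ℝ ∞ A₁ (p 2, p 3)) (hA₂ : ContDiffAt ℝ ∞ A₂ (p 2, p 3))
    (hdA : ∀ᶠ q in nhds (p 2, p 3), dX A₂ q - dY A₁ q = h q)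
    (hF0 : F (p 0) ≠ 0) (hG0 : G (p 0) ≠ 0) (hH0 : H (p 0) ≠ 0) (hh0 : h (p 2, p 3) ≠ 0)
    (a b c d : Fin 4) :
    riemann (metric F G H h A₁ A₂) a b c d p
      = (pointData F G H h A₁ A₂ p).curvForm (pointData F G H h A₁ A₂ p).rm01
        (pointData F G H h A₁ A₂ p).rm23 (pointData F G H h A₁ A₂ p).rm0123
        (pointData F G H h A₁ A₂ p).rm02 (pointData F G H h A₁ A₂ p).rm12 a b c d := by
  have hj := hasJet_metric hF hG hH hh hA₁ hA₂ hdA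
  have hdet : (metric F G H h A₁ A₂ p).det ≠ 0 := by
    rw [det_metric]; positivity
  rw [← PointData.rm_eq _ hF0 hG0 hH0 hh0, riemann_eq (metric_symm F G H h A₁ A₂)
    (fun i j => (hj i j).contDiffAt) hdet]
  have hlow : ∀ a b c, christoffelLow (metric F G H h A₁ A₂) a b c p
      = (pointData F G H h A₁ A₂ p).gammaLow a b c := fun a b c => by
    simp only [christoffelLow, PointData.gammaLow, (hj _ _).d]
  simp only [(hj _ _).dd, hlow, inv_metric hF0 hG0 hH0 hh0, PointData.rm]
  congr 1
  simp only [PointData.metricInv, PointData.gammaFrame, Fin.sum_univ_four]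
  ring

lemma weyl_metric (hF : ContDiffAt ℝ ∞ F (p 0)) (hG : ContDiffAt ℝ ∞ G (p 0))
    (hH : ContDiffAt ℝ ∞ H (p 0)) (hh : ContDiffAt ℝ ∞ h (p 2, p 3))
    (hA₁ : ContDiffAt ℝ ∞ A₁ (p 2, p 3)) (hA₂ : ContDiffAt ℝ ∞ A₂ (p 2, p 3))
    (hdA : ∀ᶠ q in nhds (p 2, p 3), dX A₂ q - dY A₁ q = h q)
    (hF0 : F (p 0) ≠ 0) (hG0 : G (p 0) ≠ 0) (hH0 : H (p 0) ≠ 0) (hh0 : h (p 2, p 3) ≠ 0)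
    (a b c d : Fin 4) :
    weyl (metric F G H h A₁ A₂) a b c d p
      = (pointData F G H h A₁ A₂ p).weylForm (pointData F G H h A₁ A₂ p).weylEven
        (pointData F G H h A₁ A₂ p).rm0123 a b c d := by
  have hdet : (metric F G H h A₁ A₂ p).det ≠ 0 := by
    rw [det_metric]; positivity
  have hR := riemann_metric hF hG hH hh hA₁ hA₂ hdA hF0 hG0 hH0 hh0
  have hinv := inv_metric (A₁ := A₁) (A₂ := A₂) hF0 hG0 hH0 hh0
  have hm := fun c d => metric_eq_metricVal (F := F) (G := G) (H := H) (h := h) (A₁ := A₁)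
    (A₂ := A₂) (p := p) c d
  have hF0' : (pointData F G H h A₁ A₂ p).F ≠ 0 := hF0
  have hG0' : (pointData F G H h A₁ A₂ p).G ≠ 0 := hG0
  have hH0' : (pointData F G H h A₁ A₂ p).H ≠ 0 := hH0
  have hh0' : (pointData F G H h A₁ A₂ p).h ≠ 0 := hh0
  generalize hD : pointData F G H h A₁ A₂ p = D at *
  -- Rescaled to sectional curvatures, the form in which the contraction lemmas apply; their values
  -- are then forgotten.
  have e1 : D.rm01 = D.rm01 / (D.F * D.G) * (D.F * D.G) := by field_simp
  have e2 : D.rm23 = D.rm23 / (D.H * D.h) ^ 2 * (D.H * D.h) ^ 2 := by field_simp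
  have e4 : D.rm02 = D.rm02 / (D.F * (D.H * D.h)) * (D.F * (D.H * D.h)) := by field_simp
  have e5 : D.rm12 = D.rm12 / (D.G * (D.H * D.h)) * (D.G * (D.H * D.h)) := by field_simp
  rw [e1, e2, e4, e5] at hR
  have hu : D.weylEven = (D.rm01 / (D.F * D.G) + D.rm23 / (D.H * D.h) ^ 2
    - D.rm02 / (D.F * (D.H * D.h)) - D.rm12 / (D.G * (D.H * D.h))) / 3 := rfl
  generalize D.rm01 / (D.F * D.G) = k₁ at hR hu
  generalize D.rm23 / (D.H * D.h) ^ 2 = k₂ at hR hu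
  generalize D.rm02 / (D.F * (D.H * D.h)) = k₄ at hR hu
  generalize D.rm12 / (D.G * (D.H * D.h)) = k₅ at hR hu
  have hRic : ∀ b d, ricci (metric F G H h A₁ A₂) b d p
      = D.diagForm (D.F * (k₁ + 2 * k₄)) (D.G * (k₁ + 2 * k₅))
        (D.H * D.h * (k₂ + k₄ + k₅)) b d := fun b d => by
    rw [ricci_eq hdet]
    simp only [hinv, hR]
    exact D.ricci_curvForm k₁ k₂ _ k₄ k₅ hF0' hG0' hH0' hh0' b d
  have hS : scalarCurvature (metric F G H h A₁ A₂) p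
      = (k₁ + 2 * k₄) + (k₁ + 2 * k₅) + 2 * (k₂ + k₄ + k₅) := by
    simp only [scalarCurvature, hinv, hRic]
    exact D.scalar_diagForm _ _ _ hF0' hG0' hH0' hh0'
  simp only [weyl, hRic, hS, hR, hm]
  rw [D.weyl_curvForm, PointData.weylForm, hu]
  have e6 : (k₁ + k₂ - k₄ - k₅) / 3 / 2 = (k₁ + k₂ - k₄ - k₅) / 6 := by ring
  rw [e6]

lemma hodgeWeyl_metric (hF : ContDiffAt ℝ ∞ F (p 0)) (hG : ContDiffAt ℝ ∞ G (p 0))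
    (hH : ContDiffAt ℝ ∞ H (p 0)) (hh : ContDiffAt ℝ ∞ h (p 2, p 3))
    (hA₁ : ContDiffAt ℝ ∞ A₁ (p 2, p 3)) (hA₂ : ContDiffAt ℝ ∞ A₂ (p 2, p 3))
    (hdA : ∀ᶠ q in nhds (p 2, p 3), dX A₂ q - dY A₁ q = h q)
    (hF0 : 0 < F (p 0)) (hG0 : 0 < G (p 0)) (hH0 : 0 < H (p 0)) (hh0 : 0 < h (p 2, p 3))
    (a b c d : Fin 4) :
    hodgeWeyl (metric F G H h A₁ A₂) a b c d p
      = (pointData F G H h A₁ A₂ p).weylForm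
        ((pointData F G H h A₁ A₂ p).rm0123
          / (√(F (p 0) * G (p 0)) * (H (p 0) * h (p 2, p 3))))
        ((pointData F G H h A₁ A₂ p).weylEven
          * (√(F (p 0) * G (p 0)) * (H (p 0) * h (p 2, p 3)))) a b c d := by
  have hdet : √(metric F G H h A₁ A₂ p).det
      = √(F (p 0) * G (p 0)) * (H (p 0) * h (p 2, p 3)) := by
    rw [det_metric, Real.sqrt_mul (by positivity), Real.sqrt_sq (by positivity)]
  simp only [hodgeWeyl, volumeForm, hdet, inv_metric hF0.ne' hG0.ne' hH0.ne' hh0.ne',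
    weyl_metric hF hG hH hh hA₁ hA₂ hdA hF0.ne' hG0.ne' hH0.ne' hh0.ne']
  exact (pointData F G H h A₁ A₂ p).star_weylForm hF0.ne' hG0.ne' hH0.ne' hh0.ne'
    (Real.sq_sqrt (mul_pos hF0 hG0).le) _ _ a b c d

lemma surfCurv_pointData (hh : ContDiffAt ℝ ∞ h (p 2, p 3)) (hh0 : h (p 2, p 3) ≠ 0) :
    (pointData F G H h A₁ A₂ p).surfCurv = surfaceCurvature h (p 2, p 3) := by
  have hev : ∀ᶠ w in nhds (p 2, p 3), DifferentiableAt ℝ h w ∧ h w ≠ 0 :=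
    (((hh.of_le (m := 1) (by simp)).eventually (by simp)).mono
      fun _ h => h.differentiableAt (by norm_num)).and (hh.continuousAt.eventually_ne hh0)
  have hd := hh.differentiableAt (by simp)
  have key : ∀ v : ℝ × ℝ, DifferentiableAt ℝ (fun w => fderiv ℝ h w v) (p 2, p 3) →
      fderiv ℝ (fun w => fderiv ℝ (fun w => Real.log (h w)) w v) (p 2, p 3) v
      = (fderiv ℝ (fun w => fderiv ℝ h w v) (p 2, p 3) v * h (p 2, p 3)
        - fderiv ℝ h (p 2, p 3) v ^ 2) / h (p 2, p 3) ^ 2 := by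
    intro v hv
    have h1 : (fun w => fderiv ℝ (fun w => Real.log (h w)) w v) =ᶠ[nhds (p 2, p 3)]
        fun w => (h w)⁻¹ * fderiv ℝ h w v := by
      filter_upwards [hev] with w hw
      rw [(hw.1.hasFDerivAt.log hw.2).fderiv]
      simp
    have h2 : HasFDerivAt (fun w => (h w)⁻¹ * fderiv ℝ h w v) _ (p 2, p 3) :=
      ((hasDerivAt_inv hh0).comp_hasFDerivAt _ hd.hasFDerivAt).mul hv.hasFDerivAt
    rw [h1.fderiv_eq, h2.fderiv]
    simp
    field_simp
    ring
  have hX := key (1, 0) ((contDiffAt_dX hh).differentiableAt (by simp))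
  have hY := key (0, 1) ((contDiffAt_dY hh).differentiableAt (by simp))
  simp only [surfaceCurvature, PointData.surfCurv, pointData]
  unfold dX dY at *
  rw [hX, hY]
  field_simp

/-- The pointwise condition `*C = -s C`. -/
lemma hodgeWeyl_eq_iff (hF : ContDiffAt ℝ ∞ F (p 0)) (hG : ContDiffAt ℝ ∞ G (p 0))
    (hH : ContDiffAt ℝ ∞ H (p 0)) (hh : ContDiffAt ℝ ∞ h (p 2, p 3))
    (hA₁ : ContDiffAt ℝ ∞ A₁ (p 2, p 3)) (hA₂ : ContDiffAt ℝ ∞ A₂ (p 2, p 3))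
    (hdA : ∀ᶠ q in nhds (p 2, p 3), dX A₂ q - dY A₁ q = h q)
    (hF0 : 0 < F (p 0)) (hG0 : 0 < G (p 0)) (hH0 : 0 < H (p 0)) (hh0 : 0 < h (p 2, p 3))
    {s : ℝ} (hs : s ^ 2 = 1) :
    (∀ i j k l : Fin 4, hodgeWeyl (metric F G H h A₁ A₂) i j k l p
        = -s * weyl (metric F G H h A₁ A₂) i j k l p)
      ↔ (pointData F G H h A₁ A₂ p).ratio₂
        + 3 * s * (H (p 0) / √(F (p 0) * G (p 0)) * (pointData F G H h A₁ A₂ p).ratio₁)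
        + 2 * (G (p 0) / H (p 0)) = surfaceCurvature h (p 2, p 3) := by
  have hu := (pointData F G H h A₁ A₂ p).weylEven_eq hF0.ne' hG0.ne' hH0.ne' hh0.ne'
  have hm := (pointData F G H h A₁ A₂ p).rm0123_eq hH0.ne'
  simp only [hodgeWeyl_metric hF hG hH hh hA₁ hA₂ hdA hF0 hG0 hH0 hh0,
    weyl_metric hF hG hH hh hA₁ hA₂ hdA hF0.ne' hG0.ne' hH0.ne' hh0.ne']
  rw [← surfCurv_pointData (F := F) (G := G) (H := H) (A₁ := A₁) (A₂ := A₂) hh hh0.ne']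
  have hF' : F (p 0) = (pointData F G H h A₁ A₂ p).F := rfl
  have hG' : G (p 0) = (pointData F G H h A₁ A₂ p).G := rfl
  have hH' : H (p 0) = (pointData F G H h A₁ A₂ p).H := rfl
  have hh' : h (p 2, p 3) = (pointData F G H h A₁ A₂ p).h := rfl
  have hσ0 : 0 < √(F (p 0) * G (p 0)) := Real.sqrt_pos.2 (mul_pos hF0 hG0)
  rw [hF', hG'] at hσ0 ⊢
  rw [hF'] at hF0
  rw [hG'] at hG0
  rw [hH'] at hH0 ⊢
  rw [hh'] at hh0 ⊢
  generalize pointData F G H h A₁ A₂ p = D at *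
  generalize √(D.F * D.G) = σ at *
  have hscalar : D.rm0123 / (σ * (D.H * D.h)) = -s * D.weylEven
      ↔ D.ratio₂ + 3 * s * (D.H / σ * D.ratio₁) + 2 * (D.G / D.H) = D.surfCurv := by
    have hdiff : D.rm0123 / (σ * (D.H * D.h)) - -s * D.weylEven = -(1 / (6 * D.H)) *
        (3 * (D.H / σ * D.ratio₁) + s * (D.ratio₂ + 2 * (D.G / D.H) - D.surfCurv)) := by
      rw [hu, hm]
      field_simp
      ring
    -- The bracket is `s` times the desired equation because `s² = 1`; multiplying by `s` passes
    -- either way.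
    rw [← sub_eq_zero, hdiff, mul_eq_zero, or_iff_right (by simp [hH0.ne'])]
    constructor
    · intro e
      linear_combination s * e - (D.ratio₂ + 2 * (D.G / D.H) - D.surfCurv) * hs
    · intro e
      linear_combination s * e - 3 * (D.H / σ * D.ratio₁) * hs
  rw [← hscalar]
  constructor
  · intro hall
    -- This component isolates the even coefficient.
    have h0 := hall 0 1 0 1
    rw [D.weylForm_0101, D.weylForm_0101, ← mul_assoc (-s)] at h0
    exact mul_right_cancel₀ (mul_pos hF0 hG0).ne' h0
  · intro e i j k l
    -- The equation for the mixed coefficient is equivalent to the even one, the star being an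
    -- involution.
    have e' : D.weylEven * (σ * (D.H * D.h)) = -s * D.rm0123 := by
      rw [div_eq_iff (by positivity)] at e
      rw [e]
      linear_combination (-D.weylEven * (σ * (D.H * D.h))) * hs
    rw [e, e', D.weylForm_mul]

end

/-! ### The radial equation -/

lemma eq_const_of_hasDerivAt_zero {I : Set ℝ} (hI : IsOpen I) (hI' : I.OrdConnected)
    {f : ℝ → ℝ} (hf : ∀ r ∈ I, HasDerivAt f 0 r) {r₀ : ℝ} (hr₀ : r₀ ∈ I) :
    ∀ r ∈ I, f r = f r₀ := fun _ hr =>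
  hI.is_const_of_deriv_eq_zero hI'.isPreconnected
    (fun x hx => (hf x hx).differentiableAt.differentiableWithinAt)
    (fun x hx => (hf x hx).deriv) hr hr₀

/-- The general solution of `y'' + 3 s y' + 2 y = k`, where `s = ±1` and derivatives are taken with
respect to the variable `z`. -/
lemma ode_iff {I : Set ℝ} (hI : IsOpen I) (hI' : I.OrdConnected) {r₀ : ℝ} (hr₀ : r₀ ∈ I)
    {ρ z y y₁ y₂ : ℝ → ℝ} (hρ : ∀ r ∈ I, ρ r ≠ 0) (hz : ∀ r ∈ I, HasDerivAt z (ρ r) r)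
    (hy : ∀ r ∈ I, HasDerivAt y (ρ r * y₁ r) r) (hy₁ : ∀ r ∈ I, HasDerivAt y₁ (ρ r * y₂ r) r)
    {s : ℝ} (hs : s ^ 2 = 1) (k : ℝ) :
    (∀ r ∈ I, y₂ r + 3 * s * y₁ r + 2 * y r = k) ↔
      ∃ a b : ℝ, ∀ r ∈ I,
        y r = k / 2 + b * Real.exp (-(s * z r)) + a * Real.exp (-(s * z r)) ^ 2 := by
  constructor
  · intro hode
    have hE : ∀ r ∈ I, HasDerivAt (fun r => Real.exp (s * z r))
        (Real.exp (s * z r) * (s * ρ r)) r := fun r hr => ((hz r hr).const_mul s).exp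
    -- As `s² = 1`, the operator factors as `(D + s)(D + 2s)`. Hence `y₁ + 2s(y - k/2)` is
    -- annihilated by `D + s` and becomes constant after multiplication by `e^{sz}`; in `hβ` the
    -- roles are exchanged, with factor `e^{2sz}`.
    have hα := eq_const_of_hasDerivAt_zero hI hI'
      (f := fun r => Real.exp (s * z r) * (y₁ r + 2 * s * (y r - k / 2))) (fun r hr => by
        have := (hE r hr).fun_mul
          ((hy₁ r hr).fun_add (((hy r hr).sub_const (k / 2)).const_mul (2 * s)))
        refine this.congr_deriv ?_
        linear_combination ((Real.exp (s * z r)) * ρ r) * hode r hr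
          + Real.exp (s * z r) * ρ r * (2 * y r - k) * hs) hr₀
    have hβ := eq_const_of_hasDerivAt_zero hI hI'
      (f := fun r => Real.exp (s * z r) * Real.exp (s * z r) * (y₁ r + s * (y r - k / 2)))
      (fun r hr => by
        have := ((hE r hr).fun_mul (hE r hr)).fun_mul
          ((hy₁ r hr).fun_add (((hy r hr).sub_const (k / 2)).const_mul s))
        refine this.congr_deriv ?_
        linear_combination ((Real.exp (s * z r)) ^ 2 * ρ r) * hode r hr
          + Real.exp (s * z r) ^ 2 * ρ r * (2 * y r - k) * hs) hr₀
    generalize Real.exp (s * z r₀) * (y₁ r₀ + 2 * s * (y r₀ - k / 2)) = β at hα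
    generalize Real.exp (s * z r₀) * Real.exp (s * z r₀) * (y₁ r₀ + s * (y r₀ - k / 2)) = α at hβ
    -- The difference of the two first integrals, without their exponentials, is `s (y - k/2)`;
    -- multiplying by `s` recovers `y - k/2`.
    refine ⟨-(s * α), s * β, fun r hr => ?_⟩
    have hexp : Real.exp (s * z r) * Real.exp (-(s * z r)) = 1 := by
      rw [← Real.exp_add]; simp
    rw [← hα r hr, ← hβ r hr]
    generalize Real.exp (-(s * z r)) = e at *
    generalize Real.exp (s * z r) = E at *
    have h2 : E * e * (E * e) = 1 := by rw [hexp, one_mul]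
    linear_combination (-s * (y₁ r + 2 * s * (y r - k / 2))) * hexp
      + (s * (y₁ r + s * (y r - k / 2))) * h2 - (y r - k / 2) * hs
  · rintro ⟨a, b, hab⟩
    have hE : ∀ r ∈ I, HasDerivAt (fun r => Real.exp (-(s * z r)))
        (Real.exp (-(s * z r)) * -(s * ρ r)) r :=
      fun r hr => ((hz r hr).const_mul s).fun_neg.exp
    -- Differentiating the formula on the open set `I` and cancelling `ρ` determines `y₁`, and then
    -- `y₂` likewise.
    have h1 : ∀ r ∈ I, y₁ r = -s * b * Real.exp (-(s * z r))
        - 2 * s * a * Real.exp (-(s * z r)) ^ 2 := by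
      intro r hr
      have hd : HasDerivAt y _ r := ((((hE r hr).const_mul b).const_add (k / 2)).fun_add
        (((hE r hr).fun_pow 2).const_mul a)).congr_of_eventuallyEq
          (Filter.eventually_of_mem (hI.mem_nhds hr) hab)
      have := (hy r hr).unique hd
      apply mul_left_cancel₀ (hρ r hr)
      rw [this]
      push_cast
      ring
    have h2 : ∀ r ∈ I, y₂ r = b * Real.exp (-(s * z r)) + 4 * a * Real.exp (-(s * z r)) ^ 2 := by
      intro r hr
      have hd : HasDerivAt y₁ _ r := (((hE r hr).const_mul (-s * b)).fun_sub
        (((hE r hr).fun_pow 2).const_mul (2 * s * a))).congr_of_eventuallyEq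
          (Filter.eventually_of_mem (hI.mem_nhds hr) h1)
      have := (hy₁ r hr).unique hd
      apply mul_left_cancel₀ (hρ r hr)
      rw [this]
      push_cast
      linear_combination
        (ρ r * (b * Real.exp (-(s * z r)) + 4 * a * Real.exp (-(s * z r)) ^ 2)) * hs
    intro r hr
    rw [h1 r hr, h2 r hr, hab r hr]
    linear_combination (-3 * b * Real.exp (-(s * z r)) - 6 * a * Real.exp (-(s * z r)) ^ 2) * hs

section

variable {I : Set ℝ} {F G H : ℝ → ℝ}

/-- The second derivative of `G / H` with respect to the primitive of `√(F G) / H`. -/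
lemma hasDerivAt_ratio {h A₁ A₂ : ℝ × ℝ → ℝ} {x y r : ℝ} (hF : ContDiffAt ℝ ∞ F r)
    (hG : ContDiffAt ℝ ∞ G r) (hH : ContDiffAt ℝ ∞ H r)
    (hF0 : 0 < F r) (hG0 : 0 < G r) (hH0 : 0 < H r) :
    HasDerivAt (fun t => H t / √(F t * G t) * (pointData F G H h A₁ A₂ ![t, 0, x, y]).ratio₁)
      (√(F r * G r) / H r * (pointData F G H h A₁ A₂ ![r, 0, x, y]).ratio₂) r := by
  have dF := (hF.differentiableAt (by simp)).hasDerivAt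
  have dG := (hG.differentiableAt (by simp)).hasDerivAt
  have dH := (hH.differentiableAt (by simp)).hasDerivAt
  have dG' := ((contDiffAt_deriv hG).differentiableAt (by simp)).hasDerivAt
  have dH' := ((contDiffAt_deriv hH).differentiableAt (by simp)).hasDerivAt
  have hσ0 : 0 < √(F r * G r) := Real.sqrt_pos.2 (mul_pos hF0 hG0)
  have hσ : √(F r * G r) ^ 2 = F r * G r := Real.sq_sqrt (mul_pos hF0 hG0).le
  have hd := (dH.fun_div ((dF.fun_mul dG).sqrt (mul_pos hF0 hG0).ne') hσ0.ne').fun_mul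
    (((dG'.fun_mul dH).fun_sub (dG.fun_mul dH')).fun_div (dH.fun_pow 2) (pow_pos hH0 2).ne')
  simp only [PointData.ratio₁, PointData.ratio₂, pointData, Matrix.cons_val_zero]
  refine hd.congr_deriv ?_
  generalize √(F r * G r) = σ at *
  -- Eliminating `G r` makes the identity rational in `σ`.
  have hG' : G r = σ ^ 2 / F r := by rw [hσ]; field_simp
  rw [hG']
  push_cast
  field_simp
  ring

lemma hasDerivAt_integral (hI : IsOpen I) (hI' : I.OrdConnected) (hF : ContinuousOn F I)
    (hG : ContinuousOn G I) (hH : ContinuousOn H I) (hHpos : ∀ r ∈ I, 0 < H r)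
    {r₀ r : ℝ} (hr₀ : r₀ ∈ I) (hr : r ∈ I) :
    HasDerivAt (fun r => ∫ t in r₀..r, √(F t * G t) / H t) (√(F r * G r) / H r) r := by
  have hc : ContinuousOn (fun t => √(F t * G t) / H t) I :=
    (hF.mul hG).sqrt.div hH fun t ht => (hHpos t ht).ne'
  refine intervalIntegral.integral_hasDerivAt_right
    ((hc.mono (hI'.uIcc_subset hr₀ hr)).intervalIntegrable)
    (hc.stronglyMeasurableAtFilter hI r hr) (hc.continuousAt (hI.mem_nhds hr))

end
end PagePope

end

/-- With `s = 1` (upper signs) and `s = -1` (lower signs): the Page–Pope metric satisfies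
`*C = -s C` iff `g_Σ` has constant curvature `k = R_Σ` and
`G = (k / 2) H + b / Ω² + a / (Ω⁴ H)` for some constants `a`, `b`. -/
theorem mainTheorem3
    (I : Set ℝ) (hI : IsOpen I) (hI' : I.OrdConnected)
    (U : Set (ℝ × ℝ)) (hU : IsOpen U) (hU' : U.Nonempty)
    (F G H : ℝ → ℝ)
    (hF : ContDiffOn ℝ ∞ F I) (hG : ContDiffOn ℝ ∞ G I) (hH : ContDiffOn ℝ ∞ H I)
    (hFpos : ∀ r ∈ I, 0 < F r) (hGpos : ∀ r ∈ I, 0 < G r) (hHpos : ∀ r ∈ I, 0 < H r)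
    (h A₁ A₂ : ℝ × ℝ → ℝ)
    (hh : ContDiffOn ℝ ∞ h U) (hhpos : ∀ q ∈ U, 0 < h q)
    (hA₁ : ContDiffOn ℝ ∞ A₁ U) (hA₂ : ContDiffOn ℝ ∞ A₂ U)
    (hdA : ∀ q ∈ U, PagePope.dX A₂ q - PagePope.dY A₁ q = h q)
    (s : ℝ) (hs : s = 1 ∨ s = -1)
    (c : ℝ) (hc : 0 < c) (r₀ : ℝ) (hr₀ : r₀ ∈ I) :
    (∀ p ∈ PagePope.domain I U, ∀ i j k l : Fin 4,
        LocalGeometry.hodgeWeyl (PagePope.metric F G H h A₁ A₂) i j k l p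
          = -s * LocalGeometry.weyl (PagePope.metric F G H h A₁ A₂) i j k l p)
    ↔ ∃ k : ℝ, (∀ q ∈ U, PagePope.surfaceCurvature h q = k) ∧
        ∃ a b : ℝ, ∀ r ∈ I,
          G r = k / 2 * H r + b / PagePope.OmegaSq F G H s c r₀ r
            + a / ((PagePope.OmegaSq F G H s c r₀ r) ^ 2 * H r) := by
  have hs2 : s ^ 2 = 1 := by rcases hs with rfl | rfl <;> norm_num
  -- The ratios involve radial data only, so the surface point `(0, 0)` is a dummy and need not lie
  -- in `U`.
  set y₁ : ℝ → ℝ := fun r => H r / √(F r * G r)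
    * (PagePope.pointData F G H h A₁ A₂ ![r, 0, 0, 0]).ratio₁ with hy₁
  set y₂ : ℝ → ℝ := fun r => (PagePope.pointData F G H h A₁ A₂ ![r, 0, 0, 0]).ratio₂ with hy₂
  set z : ℝ → ℝ := fun r => ∫ t in r₀..r, √(F t * G t) / H t with hz
  have hcF := fun r hr => hF.contDiffAt (hI.mem_nhds (x := r) hr)
  have hcG := fun r hr => hG.contDiffAt (hI.mem_nhds (x := r) hr)
  have hcH := fun r hr => hH.contDiffAt (hI.mem_nhds (x := r) hr)
  have hpoint : (∀ p ∈ PagePope.domain I U, ∀ i j k l : Fin 4,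
        LocalGeometry.hodgeWeyl (PagePope.metric F G H h A₁ A₂) i j k l p
          = -s * LocalGeometry.weyl (PagePope.metric F G H h A₁ A₂) i j k l p)
      ↔ ∀ r ∈ I, ∀ q ∈ U,
        y₂ r + 3 * s * y₁ r + 2 * (G r / H r) = PagePope.surfaceCurvature h q := by
    have hp : ∀ p ∈ PagePope.domain I U, _ := fun p hp =>
      PagePope.hodgeWeyl_eq_iff (p := p) (hcF _ hp.1) (hcG _ hp.1) (hcH _ hp.1)
        (hh.contDiffAt (hU.mem_nhds hp.2)) (hA₁.contDiffAt (hU.mem_nhds hp.2))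
        (hA₂.contDiffAt (hU.mem_nhds hp.2)) (Filter.eventually_of_mem (hU.mem_nhds hp.2) hdA)
        (hFpos _ hp.1) (hGpos _ hp.1) (hHpos _ hp.1) (hhpos _ hp.2) hs2
    constructor
    · intro hall r hr q hq
      have hmem : (![r, 0, q.1, q.2] : Fin 4 → ℝ) ∈ PagePope.domain I U := ⟨hr, hq⟩
      exact (hp _ hmem).1 (hall _ hmem)
    · intro hall p hmem
      exact (hp p hmem).2 (hall _ hmem.1 _ hmem.2)
  have hode := PagePope.ode_iff hI hI' hr₀ (ρ := fun r => √(F r * G r) / H r) (z := z)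
    (y := fun r => G r / H r) (y₁ := y₁) (y₂ := y₂)
    (fun r hr => (div_pos (Real.sqrt_pos.2 (mul_pos (hFpos r hr) (hGpos r hr))) (hHpos r hr)).ne')
    (fun r hr => PagePope.hasDerivAt_integral hI hI' hF.continuousOn hG.continuousOn
      hH.continuousOn hHpos hr₀ hr)
    (fun r hr => by
      have hσ0 : 0 < √(F r * G r) := Real.sqrt_pos.2 (mul_pos (hFpos r hr) (hGpos r hr))
      have hH0 := hHpos r hr
      refine (((hcG r hr).differentiableAt (by simp)).hasDerivAt.fun_div
        ((hcH r hr).differentiableAt (by simp)).hasDerivAt hH0.ne').congr_deriv ?_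
      simp only [hy₁, PagePope.PointData.ratio₁, PagePope.pointData, Matrix.cons_val_zero]
      generalize √(F r * G r) = σ at hσ0 ⊢
      field_simp)
    (fun r hr => PagePope.hasDerivAt_ratio (hcF r hr) (hcG r hr) (hcH r hr) (hFpos r hr)
      (hGpos r hr) (hHpos r hr)) hs2
  have hsol : ∀ k : ℝ, (∃ a b : ℝ, ∀ r ∈ I, G r / H r
        = k / 2 + b * Real.exp (-(s * z r)) + a * Real.exp (-(s * z r)) ^ 2) ↔
      ∃ a b : ℝ, ∀ r ∈ I, G r = k / 2 * H r + b / PagePope.OmegaSq F G H s c r₀ r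
            + a / ((PagePope.OmegaSq F G H s c r₀ r) ^ 2 * H r) := by
    -- Since `H e^{-sz} = c/Ω²` and `H e^{-2sz} = c²/(Ω⁴ H)`, the constants are rescaled by `c` and
    -- `c²`.
    have hiff : ∀ k a b r, r ∈ I → (G r / H r
        = k / 2 + b * Real.exp (-(s * z r)) + a * Real.exp (-(s * z r)) ^ 2 ↔
      G r = k / 2 * H r + (b * c) / PagePope.OmegaSq F G H s c r₀ r
            + (a * c ^ 2) / ((PagePope.OmegaSq F G H s c r₀ r) ^ 2 * H r)) := by
      intro k a b r hr
      have hH0 := hHpos r hr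
      have hE := Real.exp_pos (s * z r)
      rw [div_eq_iff hH0.ne', Real.exp_neg, PagePope.OmegaSq]
      change _ ↔ G r = k / 2 * H r + (b * c) / (c / H r * Real.exp (s * z r))
            + (a * c ^ 2) / ((c / H r * Real.exp (s * z r)) ^ 2 * H r)
      apply Eq.congr_right
      field_simp
    intro k
    constructor
    · rintro ⟨a, b, hab⟩
      exact ⟨a * c ^ 2, b * c, fun r hr => (hiff k a b r hr).1 (hab r hr)⟩
    · rintro ⟨a, b, hab⟩
      refine ⟨a / c ^ 2, b / c, fun r hr => (hiff k _ _ r hr).2 ?_⟩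
      rw [div_mul_cancel₀ _ hc.ne', div_mul_cancel₀ _ (pow_pos hc 2).ne']
      exact hab r hr
  rw [hpoint]
  constructor
  · intro hall
    -- Separation of variables: fixing `r₀` shows that the curvature is constant, and fixing `q₀`
    -- leaves the equation in `r`.
    obtain ⟨q₀, hq₀⟩ := hU'
    refine ⟨PagePope.surfaceCurvature h q₀, fun q hq => ?_, ?_⟩
    · rw [← hall r₀ hr₀ q hq, ← hall r₀ hr₀ q₀ hq₀]
    · exact (hsol _).1 ((hode _).1 fun r hr => hall r hr q₀ hq₀)
  · rintro ⟨k, hk, hab⟩ r hr q hq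
    rw [hk q hq]
    exact (hode k).2 ((hsol k).2 hab) r hr
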